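/- Theorem 1.2. Let $n\ge 2$, let $\mathrm dm$ be the surface measure on $\mathbb S^{n-1}$, and for $\eta\in\mathbb R$ put $$\sigma_1(\eta)=\frac{(n-1)\int_0^{\pi/2}e^{\eta\sin^2\theta}\cos^{n-2}\theta\,\mathrm d\theta}{2\int_0^{\pi/2}e^{\eta\sin^2\theta}\sin^2\theta\cos^{n}\theta\,\mathrm d\theta}.$$ The function $\sigma_1$ has a unique global minimum point $\eta_1^*$ on $\mathbb R$. Let $\eta>\eta_1^*$, $\alpha=\sigma_1(\eta)$, $\nu\in\mathbb S^{n-1}$ and $$h_\nu(m)=\frac{e^{\eta(m\cdot\nu)^2}}{\int_{\mathbb S^{n-1}}e^{\eta(m'\cdot\nu)^2}\,\mathrm dm'},\qquad m\in\mathbb S^{n-1}.$$ Then $h_\nu$ is a critical point of the Onsager energy $$\mathcal A[f]=\int_{\mathbb S^{n-1}} f\log f\,\mathrm dm+\frac\alpha2\int_{\mathbb S^{n-1}\times\mathbb S^{n-1}}\big(1-(m\cdot m')^2\big)f(m)f(m')\,\mathrm dm\,\mathrm dm',$$ that is, it is positive, $\int_{\mathbb S^{n-1}} h_\nu\,\mathrm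 dm=1$, and $\log h_\nu(m)-\alpha\int_{\mathbb S^{n-1}}(m\cdot m')^2h_\nu(m')\,\mathrm dm'$ is constant on $\mathbb S^{n-1}$. Let $V=\{\phi\in L^2(\mathbb S^{n-1}):\int_{\mathbb S^{n-1}}\phi\,\mathrm dm=0\}$, and let $\mathcal H_{h_\nu}:V\to V$ be the second variation of $\mathcal A$ at $h_\nu$, $$\mathcal H_{h_\nu}\phi=g_\phi-\frac{1}{|\mathbb S^{n-1}|}\int_{\mathbb S^{n-1}}g_\phi\,\mathrm dm,\qquad g_\phi(m)=\frac{\phi(m)}{h_\nu(m)}-\alpha\int_{\mathbb S^{n-1}}(m\cdot m')^2\phi(m')\,\mathrm dm'.$$ Then $$\operatorname{Ker}\mathcal H_{h_\nu}=V_\nu^\top:=\big\{u\cdot[m-\nu(m\cdot\nu)]\,(m\cdot\nu)\,h_\nu(m):u\in\mathbb R^n\big\}.$$ Moreover, there is a constant $c_0=c_0(\eta,n)>0$, independent of $\nu$, such that $$\langle\mathcal H_{h_\nu}\psi,\psi\rangle_{L^2(\mathbb S^{n-1})}\ge c_0\|\psi\|^2_{L^2(\mathbb S^{n-1})}$$ for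 every $\psi\in V$ with $\langle\psi,\phi\rangle_{L^2(\mathbb S^{n-1})}=0$ for all $\phi\in V_\nu^\top$. -/

import Mathlib

open MeasureTheory Real
open scoped RealInnerProductSpace ENNReal

noncomputable section

namespace Onsager

/-- The unit sphere of the Euclidean space `ℝⁿ`. -/
abbrev Sph (n : ℕ) : Type := Metric.sphere (0 : EuclideanSpace ℝ (Fin n)) 1

/-- The surface measure `dm` on the unit sphere (not normalized). -/
abbrev surf (n : ℕ) : Measure (Sph n) :=
  (volume : Measure (EuclideanSpace ℝ (Fin n))).toSphere

/-- The Hilbert space of real square integrable functions on the unit sphere. -/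
abbrev L2 (n : ℕ) : Type := Lp ℝ 2 (surf n)

/-- The function `σ_k`, for `1 ≤ k ≤ n - 1`. -/
def sigma (n k : ℕ) (η : ℝ) : ℝ :=
  (((n : ℝ) - k) * k *
      ∫ θ in (0 : ℝ)..π / 2, exp (η * sin θ ^ 2) * (sin θ ^ (k - 1) * cos θ ^ (n - k - 1))) /
    (2 * ∫ θ in (0 : ℝ)..π / 2, exp (η * sin θ ^ 2) * sin θ ^ 2 * cos θ ^ 2 *
      (sin θ ^ (k - 1) * cos θ ^ (n - k - 1)))

/-- The axisymmetric probability density `h_ν` with axis `ν` and order parameter `η`. -/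
def axial {n : ℕ} (η : ℝ) (ν m : Sph n) : ℝ :=
  exp (η * ⟪(m : EuclideanSpace ℝ (Fin n)), ν⟫ ^ 2) /
    ∫ m' : Sph n, exp (η * ⟪(m' : EuclideanSpace ℝ (Fin n)), ν⟫ ^ 2) ∂(surf n)

lemma axial_continuous {n : ℕ} (η : ℝ) (ν : Sph n) : Continuous (axial η ν) := by
  unfold axial
  fun_prop

lemma axial_pos {n : ℕ} (η : ℝ) (ν m : Sph n) : 0 < axial η ν m := by
  have : Nontrivial (EuclideanSpace ℝ (Fin n)) :=
    ⟨⟨(ν : EuclideanSpace ℝ (Fin n)), 0, ne_zero_of_mem_unit_sphere ν⟩⟩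
  refine div_pos (exp_pos _) ?_
  have : NeZero (surf n) := ⟨by simp⟩
  refine integral_exp_pos ?_
  have hc : Continuous fun m : Sph n => exp (η * ⟪(m : EuclideanSpace ℝ (Fin n)), ν⟫ ^ 2) := by
    fun_prop
  exact hc.integrable_of_hasCompactSupport (HasCompactSupport.of_compactSpace _)

/-- `f` is a critical point of the Onsager energy
`∫ f log f + (α / 2) ∫∫ (1 - (m · m')²) f(m) f(m')`: a positive probability density on the sphere
that satisfies the Euler-Lagrange equation. -/
def IsCriticalPoint {n : ℕ} (α : ℝ) (f : Sph n → ℝ) : Prop :=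
  (∀ m, 0 < f m) ∧ ∫ m, f m ∂(surf n) = 1 ∧
    ∃ C : ℝ, ∀ m : Sph n, log (f m) -
      α * ∫ m' : Sph n, ⟪(m : EuclideanSpace ℝ (Fin n)), m'⟫ ^ 2 * f m' ∂(surf n) = C

/-- The space `V` of perturbations: square integrable functions with mean zero. -/
def V (n : ℕ) : Submodule ℝ (L2 n) where
  carrier := {φ | ∫ m, φ m ∂(surf n) = 0}
  zero_mem' := by
    change ∫ m, (0 : L2 n) m ∂(surf n) = 0
    rw [integral_congr_ae (Lp.coeFn_zero ℝ 2 (surf n))]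
    simp
  add_mem' := by
    intro φ ψ hφ hψ
    have i1 := (Lp.memLp φ).integrable (by norm_num)
    have i2 := (Lp.memLp ψ).integrable (by norm_num)
    simp only [Set.mem_ofPred_eq] at *
    rw [integral_congr_ae (Lp.coeFn_add φ ψ)]
    simp only [Pi.add_apply]
    rw [integral_add i1 i2, hφ, hψ, add_zero]
  smul_mem' := by
    intro c φ hφ
    simp only [Set.mem_ofPred_eq] at *
    rw [integral_congr_ae (Lp.coeFn_smul c φ)]
    simp only [Pi.smul_apply, smul_eq_mul]
    rw [integral_const_mul, hφ, mul_zero]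

/-- The function `φ / f₀ - α ∫ (m · m')² φ(m') dm'` on the sphere. -/
def preSecondVariation {n : ℕ} (α : ℝ) (f₀ φ : Sph n → ℝ) (m : Sph n) : ℝ :=
  φ m / f₀ m -
    α * ∫ m' : Sph n, ⟪(m : EuclideanSpace ℝ (Fin n)), m'⟫ ^ 2 * φ m' ∂(surf n)

/-- The second variation of the energy
`∫ f log f + (α / 2) ∫∫ (1 - (m · m')²) f(m) f(m')` at `f₀`, applied to `φ`, as a function on the
sphere; subtracting the average takes the constraint `∫ f = 1` into account. -/
def secondVariationFun {n : ℕ} (α : ℝ) (f₀ φ : Sph n → ℝ) (m : Sph n) : ℝ :=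
  preSecondVariation α f₀ φ m - ⨍ m', preSecondVariation α f₀ φ m' ∂(surf n)

lemma memLp_preSecondVariation {n : ℕ} (α : ℝ) {f₀ : Sph n → ℝ} (hc : Continuous f₀)
    (hpos : ∀ m, 0 < f₀ m) {φ : Sph n → ℝ} (hφ : MemLp φ 2 (surf n)) :
    MemLp (preSecondVariation α f₀ φ) 2 (surf n) := by
  have hinv : Continuous fun m => (f₀ m)⁻¹ := hc.inv₀ fun m => (hpos m).ne'
  have h1 : MemLp (fun m => φ m / f₀ m) 2 (surf n) := by
    have hb : MemLp (fun m => (f₀ m)⁻¹) ∞ (surf n) := by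
      obtain ⟨C, hC⟩ := (isCompact_univ.image hinv).isBounded.exists_norm_le
      exact memLp_top_of_bound hinv.aestronglyMeasurable C
        (Filter.Eventually.of_forall fun m => hC _ ⟨m, trivial, rfl⟩)
    exact (hφ.mul (r := 2) hb).ae_eq (Filter.Eventually.of_forall fun m => by
      simp [div_eq_mul_inv, mul_comm])
  have hint : Integrable φ (surf n) := hφ.integrable (by norm_num)
  have hcont : Continuous fun m : Sph n =>
      ∫ m' : Sph n, ⟪(m : EuclideanSpace ℝ (Fin n)), m'⟫ ^ 2 * φ m' ∂(surf n) := by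
    refine continuous_of_dominated (bound := fun m' => ‖φ m'‖) ?_ ?_ hint.norm ?_
    · intro m
      have : Continuous fun m' : Sph n => ⟪(m : EuclideanSpace ℝ (Fin n)), m'⟫ ^ 2 := by fun_prop
      exact this.aestronglyMeasurable.mul hint.aestronglyMeasurable
    · intro m
      refine Filter.Eventually.of_forall fun m' => ?_
      have h := abs_real_inner_le_norm (m : EuclideanSpace ℝ (Fin n)) m'
      simp only [norm_eq_of_mem_sphere, mul_one] at h
      rw [norm_mul, norm_pow, Real.norm_eq_abs]
      exact mul_le_of_le_one_left (norm_nonneg _) (pow_le_one₀ (abs_nonneg _) h)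
    · exact Filter.Eventually.of_forall fun m' => by fun_prop
  have h2 : MemLp (fun m : Sph n =>
      α * ∫ m' : Sph n, ⟪(m : EuclideanSpace ℝ (Fin n)), m'⟫ ^ 2 * φ m' ∂(surf n)) 2 (surf n) := by
    have hcont' := continuous_const (y := α) |>.mul hcont
    obtain ⟨C, hC⟩ := (isCompact_univ.image hcont').isBounded.exists_norm_le
    exact MemLp.of_bound hcont'.aestronglyMeasurable C
      (Filter.Eventually.of_forall fun m => hC _ ⟨m, trivial, rfl⟩)
  exact h1.sub h2

lemma memLp_secondVariationFun {n : ℕ} (α : ℝ) {f₀ : Sph n → ℝ} (hc : Continuous f₀)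
    (hpos : ∀ m, 0 < f₀ m) {φ : Sph n → ℝ} (hφ : MemLp φ 2 (surf n)) :
    MemLp (secondVariationFun α f₀ φ) 2 (surf n) :=
  (memLp_preSecondVariation α hc hpos hφ).sub (memLp_const _)

lemma integral_secondVariationFun {n : ℕ} (α : ℝ) (f₀ φ : Sph n → ℝ) :
    ∫ m, secondVariationFun α f₀ φ m ∂(surf n) = 0 :=
  integral_sub_average _ _

lemma preSecondVariation_add {n : ℕ} (α : ℝ) (f₀ : Sph n → ℝ) {φ ψ χ : Sph n → ℝ}
    (hφ : Integrable φ (surf n)) (hψ : Integrable ψ (surf n)) (h : χ =ᵐ[surf n] φ + ψ) :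
    preSecondVariation α f₀ χ =ᵐ[surf n]
      preSecondVariation α f₀ φ + preSecondVariation α f₀ ψ := by
  have key : ∀ {g : Sph n → ℝ} (m : Sph n), Integrable g (surf n) →
      Integrable (fun m' : Sph n => ⟪(m : EuclideanSpace ℝ (Fin n)), m'⟫ ^ 2 * g m')
        (surf n) := by
    intro g m hg
    have hk : Continuous fun m' : Sph n => ⟪(m : EuclideanSpace ℝ (Fin n)), m'⟫ ^ 2 := by fun_prop
    refine hg.bdd_mul (c := 1) hk.aestronglyMeasurable (Filter.Eventually.of_forall fun m' => ?_)
    have h := abs_real_inner_le_norm (m : EuclideanSpace ℝ (Fin n)) m'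
    simp only [norm_eq_of_mem_sphere, mul_one] at h
    rw [norm_pow, Real.norm_eq_abs]
    exact pow_le_one₀ (abs_nonneg _) h
  filter_upwards [h] with m hm
  have e : ∫ m' : Sph n, ⟪(m : EuclideanSpace ℝ (Fin n)), m'⟫ ^ 2 * χ m' ∂(surf n) =
      (∫ m' : Sph n, ⟪(m : EuclideanSpace ℝ (Fin n)), m'⟫ ^ 2 * φ m' ∂(surf n)) +
        ∫ m' : Sph n, ⟪(m : EuclideanSpace ℝ (Fin n)), m'⟫ ^ 2 * ψ m' ∂(surf n) := by
    rw [← integral_add (key m hφ) (key m hψ)]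
    refine integral_congr_ae ?_
    filter_upwards [h] with m' hm'
    rw [hm', Pi.add_apply, mul_add]
  simp only [preSecondVariation, Pi.add_apply, e, hm]
  ring

lemma preSecondVariation_smul {n : ℕ} (α : ℝ) (f₀ : Sph n → ℝ) (c : ℝ) {φ χ : Sph n → ℝ}
    (h : χ =ᵐ[surf n] c • φ) :
    preSecondVariation α f₀ χ =ᵐ[surf n] c • preSecondVariation α f₀ φ := by
  filter_upwards [h] with m hm
  have e : ∫ m' : Sph n, ⟪(m : EuclideanSpace ℝ (Fin n)), m'⟫ ^ 2 * χ m' ∂(surf n) =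
      c * ∫ m' : Sph n, ⟪(m : EuclideanSpace ℝ (Fin n)), m'⟫ ^ 2 * φ m' ∂(surf n) := by
    rw [← integral_const_mul]
    refine integral_congr_ae ?_
    filter_upwards [h] with m' hm'
    rw [hm', Pi.smul_apply, smul_eq_mul]
    ring
  simp only [preSecondVariation, Pi.smul_apply, smul_eq_mul, e, hm]
  ring

/-- The second-variation operator `H_{f₀} : V → V` at a continuous positive density `f₀`. -/
def secondVariation {n : ℕ} (α : ℝ) (f₀ : Sph n → ℝ) (hc : Continuous f₀)
    (hpos : ∀ m, 0 < f₀ m) : V n →ₗ[ℝ] V n where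
  toFun φ :=
    ⟨(memLp_secondVariationFun α hc hpos (Lp.memLp (φ : L2 n))).toLp
        (secondVariationFun α f₀ (φ : L2 n)), by
      change ∫ m, _ ∂(surf n) = 0
      rw [integral_congr_ae (MemLp.coeFn_toLp _)]
      exact integral_secondVariationFun α f₀ (φ : L2 n)⟩
  map_add' := by
    intro φ ψ
    apply Subtype.ext
    simp only [Submodule.coe_add]
    rw [← MemLp.toLp_add]
    apply MemLp.toLp_congr
    have h := preSecondVariation_add α f₀ ((Lp.memLp (φ : L2 n)).integrable (by norm_num))
      ((Lp.memLp (ψ : L2 n)).integrable (by norm_num)) (Lp.coeFn_add (φ : L2 n) (ψ : L2 n))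
    have i1 := (memLp_preSecondVariation α hc hpos (Lp.memLp (φ : L2 n))).integrable (by norm_num)
    have i2 := (memLp_preSecondVariation α hc hpos (Lp.memLp (ψ : L2 n))).integrable (by norm_num)
    have e := average_congr h
    simp only [average_eq, Pi.add_apply, integral_add i1 i2] at e
    filter_upwards [h] with m hm
    simp only [secondVariationFun, average_eq, Pi.add_apply, hm, e, smul_add]
    ring
  map_smul' := by
    intro c φ
    apply Subtype.ext
    simp only [Submodule.coe_smul, RingHom.id_apply]
    rw [← MemLp.toLp_const_smul]
    apply MemLp.toLp_congr
    have h := preSecondVariation_smul α f₀ c (Lp.coeFn_smul c (φ : L2 n))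
    have e := average_congr h
    simp only [average_eq, Pi.smul_apply, integral_smul] at e
    filter_upwards [h] with m hm
    simp only [secondVariationFun, average_eq, Pi.smul_apply, hm, e, smul_eq_mul]
    ring

/-- The operator `H_{h_ν}`: the second variation at `h_ν`, for the interaction strength `α = σ_1(η)`
with which `h_ν` is a critical point of the energy. -/
def axialSecondVariation {n : ℕ} (η : ℝ) (ν : Sph n) : V n →ₗ[ℝ] V n :=
  secondVariation (sigma n 1 η) (axial η ν) (axial_continuous η ν) (axial_pos η ν)

/-- The space of all functions `u · [m - ν (m · ν)] (m · ν) h_ν(m)` with `u ∈ ℝⁿ`. -/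
def Vtop {n : ℕ} (η : ℝ) (ν : Sph n) : Submodule ℝ (L2 n) where
  carrier := {φ | ∃ u : EuclideanSpace ℝ (Fin n), φ =ᵐ[surf n] fun m : Sph n =>
    ⟪u, (m : EuclideanSpace ℝ (Fin n)) -
        ⟪(m : EuclideanSpace ℝ (Fin n)), ν⟫ • (ν : EuclideanSpace ℝ (Fin n))⟫ *
      ⟪(m : EuclideanSpace ℝ (Fin n)), ν⟫ * axial η ν m}
  zero_mem' := ⟨0, by
    filter_upwards [Lp.coeFn_zero ℝ 2 (surf n)] with m hm
    rw [hm]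
    simp⟩
  add_mem' := by
    rintro φ ψ ⟨u, hu⟩ ⟨v, hv⟩
    refine ⟨u + v, ?_⟩
    filter_upwards [hu, hv, Lp.coeFn_add φ ψ] with m h1 h2 h3
    rw [h3, Pi.add_apply, h1, h2, inner_add_left]
    ring
  smul_mem' := by
    rintro c φ ⟨u, hu⟩
    refine ⟨c • u, ?_⟩
    filter_upwards [hu, Lp.coeFn_smul c φ] with m h1 h2
    rw [h2, Pi.smul_apply, h1, real_inner_smul_left, smul_eq_mul]
    ring

end Onsager

end

noncomputable section

namespace Onsager

/-! Write n = d + 2, and average t = sin² θ against e^{ηt} cosᵈ θ: a = ⟨t⟩ is `sinMean`, w = ⟨t(1 -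
t)⟩ is `sinCosMean`. Then α = σ₁ = (d + 1)/(2w), so minimizing σ₁ means maximizing w. One
integration by parts gives 2ηw = (d + 2)a - 1, and a' is the variance a - a² - w > 0. Hence S = 2ηw'
(`sinSlope`) is a polynomial in a and w, and it satisfies 2ηS' + (d + 4)S = 2η(d + 2)a'(1 - 2a).
Since a increases, the right side controls the sign of S: w increases on η < 0, and once S ≤ 0 at
some η > 0 it stays negative afterwards. So w has one maximizer η* ≥ 0, and S < 0 beyond it
(`exists_sinCosMean_strict_max`).

On the sphere, take an orthonormal basis with b₀ = ν and coordinates x = m · ν, yᵢ = m · bᵢ₊₁.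
Rotation invariance gives integration by parts, hence all moments of h_ν up to degree four in terms
of a and w. The kernel (m · m')² has finite rank and splits into the blocks x², x yᵢ, yᵢyⱼ
(`inner_sq_eq_sum`). With Φ = ψ/√h_ν the second variation becomes ‖Φ‖² minus α times a sum of
squared pairings of Φ with p = (x² - a)√h_ν, qᵢ = x yᵢ√h_ν and rᵢⱼ = yᵢyⱼ√h_ν
(`inner_axialSecondVariation`).

The qᵢ are orthogonal with ‖qᵢ‖² = w/(d + 1) = 1/(2α), so their contribution is exactly the squared
norm of the projection of Φ on their span; this span is V_ν^⊤ divided by √h_ν and is the neutral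
direction. On the rest, `gram_coercive` needs two strict inequalities: one for the p block,
equivalent to S < 0, hence to η > η*; and one for the traceless part of the rᵢⱼ block, which holds
for all η > 0 (`perp_fourth_lt`). The result is a bound of the second variation by the distance from
ψ to some element of V_ν^⊤ (`exists_mem_Vtop_coercive`). It yields one inclusion for the kernel and,
by orthogonality, the spectral gap; the other inclusion is a direct computation (`Vtop_le_ker`). -/

/-! ### One-dimensional moments of sin² θ. -/

/-- The integral `∫ e^{η t} tᵏ`, with `t = sin² θ`, for the weight `cosᵈ θ` on `[0, π / 2]`. -/
def sinMoment (d k : ℕ) (η : ℝ) : ℝ :=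
  ∫ θ in (0 : ℝ)..π / 2, exp (η * sin θ ^ 2) * (sin θ ^ 2) ^ k * cos θ ^ d

/-- The integrand is the derivative of sin²ᵏ⁺¹ θ cosᵈ⁺¹ θ e^{η sin² θ}, which vanishes at both
endpoints because both exponents are positive. -/
lemma integral_sin_cos_exp_by_parts (k d : ℕ) (η : ℝ) :
    ∫ θ in (0 : ℝ)..π / 2, exp (η * sin θ ^ 2) *
      ((2 * k + 1) * (sin θ ^ 2) ^ k * cos θ ^ (d + 2) - (d + 1) * (sin θ ^ 2) ^ (k + 1) * cos θ ^ d
        + 2 * η * (sin θ ^ 2) ^ (k + 1) * cos θ ^ (d + 2)) = 0 := by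
  have hd : ∀ θ ∈ Set.uIcc (0 : ℝ) (π / 2), HasDerivAt
      (fun θ => sin θ ^ (2 * k + 1) * cos θ ^ (d + 1) * exp (η * sin θ ^ 2))
      (exp (η * sin θ ^ 2) *
      ((2 * k + 1) * (sin θ ^ 2) ^ k * cos θ ^ (d + 2) - (d + 1) * (sin θ ^ 2) ^ (k + 1) * cos θ ^ d
        + 2 * η * (sin θ ^ 2) ^ (k + 1) * cos θ ^ (d + 2))) θ := by
    intro θ _
    have h1 := (hasDerivAt_sin θ).pow (2 * k + 1)
    have h2 := (hasDerivAt_cos θ).pow (d + 1)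
    have h3 := (((hasDerivAt_sin θ).pow 2).const_mul η).exp
    refine ((h1.mul h2).mul h3).congr_deriv ?_
    simp only [Pi.pow_apply, Pi.mul_apply, Nat.add_sub_cancel]
    push_cast
    ring
  rw [intervalIntegral.integral_eq_sub_of_hasDerivAt hd
    (Continuous.intervalIntegrable (by fun_prop) _ _)]
  simp

lemma sinMoment_sub (d k : ℕ) (η : ℝ) :
    ∫ θ in (0 : ℝ)..π / 2, exp (η * sin θ ^ 2) * (sin θ ^ 2) ^ k * cos θ ^ (d + 2) =
      sinMoment d k η - sinMoment d (k + 1) η := by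
  unfold sinMoment
  rw [← intervalIntegral.integral_sub (Continuous.intervalIntegrable (by fun_prop) _ _)
    (Continuous.intervalIntegrable (by fun_prop) _ _)]
  refine intervalIntegral.integral_congr fun θ _ => ?_
  simp only [pow_add (cos θ), cos_sq' θ]
  ring

lemma sinMoment_by_parts (d k : ℕ) (η : ℝ) :
    (2 * k + 1) * (sinMoment d k η - sinMoment d (k + 1) η) - (d + 1) * sinMoment d (k + 1) η
      + 2 * η * (sinMoment d (k + 1) η - sinMoment d (k + 2) η) = 0 := by
  rw [← integral_sin_cos_exp_by_parts k d η, ← sinMoment_sub, ← sinMoment_sub, sinMoment,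
    ← intervalIntegral.integral_const_mul, ← intervalIntegral.integral_const_mul,
    ← intervalIntegral.integral_const_mul,
    ← intervalIntegral.integral_sub (Continuous.intervalIntegrable (by fun_prop) _ _)
    (Continuous.intervalIntegrable (by fun_prop) _ _),
    ← intervalIntegral.integral_add (Continuous.intervalIntegrable (by fun_prop) _ _)
    (Continuous.intervalIntegrable (by fun_prop) _ _)]
  refine intervalIntegral.integral_congr fun θ _ => ?_
  ring

lemma hasDerivAt_sinMoment (d k : ℕ) (η : ℝ) :
    HasDerivAt (sinMoment d k) (sinMoment d (k + 1) η) η := by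
  have hb : ∀ θ : ℝ, ∀ x ∈ Metric.ball η 1,
      ‖exp (x * sin θ ^ 2) * (sin θ ^ 2) ^ (k + 1) * cos θ ^ d‖ ≤ exp (|η| + 1) := by
    intro θ x hx
    have hs : sin θ ^ 2 ≤ 1 := sin_sq_le_one θ
    have hc : |cos θ| ≤ 1 := abs_cos_le_one θ
    have hx' : x ≤ |η| + 1 := by
      have := abs_lt.1 (Metric.mem_ball.1 hx : |x - η| < 1)
      have := le_abs_self η
      linarith
    have h1 : exp (x * sin θ ^ 2) ≤ exp (|η| + 1) :=
      exp_le_exp.2 (by nlinarith [sq_nonneg (sin θ), abs_nonneg η])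
    have h2 : (sin θ ^ 2) ^ (k + 1) ≤ 1 := pow_le_one₀ (sq_nonneg _) hs
    have h3 : |cos θ| ^ d ≤ 1 := pow_le_one₀ (abs_nonneg _) hc
    rw [norm_mul, norm_of_nonneg (by positivity), norm_pow, norm_eq_abs, mul_assoc]
    refine (mul_le_of_le_one_right (exp_pos _).le ?_).trans h1
    exact mul_le_one₀ h2 (by positivity) h3
  refine (intervalIntegral.hasDerivAt_integral_of_dominated_loc_of_deriv_le
    (F := fun x θ => exp (x * sin θ ^ 2) * (sin θ ^ 2) ^ k * cos θ ^ d)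
    (F' := fun x θ => exp (x * sin θ ^ 2) * (sin θ ^ 2) ^ (k + 1) * cos θ ^ d)
    (bound := fun _ => exp (|η| + 1))
    (Metric.ball_mem_nhds η one_pos) (Filter.Eventually.of_forall fun x => ?_) ?_ ?_
    (Filter.Eventually.of_forall fun θ _ => hb θ) ?_ ?_).2
  · exact Continuous.aestronglyMeasurable (by fun_prop)
  · exact Continuous.intervalIntegrable (by fun_prop) _ _
  · exact Continuous.aestronglyMeasurable (by fun_prop)
  · exact Continuous.intervalIntegrable (by fun_prop) _ _
  · refine Filter.Eventually.of_forall fun θ _ x _ => ?_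
    refine ((((hasDerivAt_id x).mul_const (sin θ ^ 2)).exp.mul_const
      ((sin θ ^ 2) ^ k)).mul_const (cos θ ^ d)).congr_deriv ?_
    simp only [id]
    ring

/-- The weighted average of a polynomial in `sin² θ` with nonnegative values is positive. -/
lemma integral_weight_pos (d : ℕ) (η : ℝ) {f : ℝ → ℝ} (hf : Continuous f) (h0 : ∀ θ, 0 ≤ f θ)
    {c : ℝ} (hc : c ∈ Set.Ioo 0 (π / 2)) (hpos : 0 < f c) :
    0 < ∫ θ in (0 : ℝ)..π / 2, exp (η * sin θ ^ 2) * f θ * cos θ ^ d := by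
  have hcos : ∀ θ ∈ Set.Icc (0 : ℝ) (π / 2), 0 ≤ cos θ := fun θ hθ =>
    cos_nonneg_of_mem_Icc ⟨by linarith [hθ.1, pi_pos], hθ.2⟩
  refine intervalIntegral.integral_pos (by positivity) (Continuous.continuousOn (by fun_prop)) ?_
    ⟨c, Set.Ioo_subset_Icc_self hc, ?_⟩
  · intro θ hθ
    have := hcos θ (Set.Ioc_subset_Icc_self hθ)
    have := h0 θ
    positivity
  · have : 0 < cos c := cos_pos_of_mem_Ioo ⟨by linarith [hc.1, pi_pos], hc.2⟩
    positivity

lemma pi_div_four_mem : π / 4 ∈ Set.Ioo 0 (π / 2) := by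
  constructor <;> linarith [pi_pos]

lemma sinMoment_zero_pos (d : ℕ) (η : ℝ) : 0 < sinMoment d 0 η := by
  simpa using! integral_weight_pos d η (f := fun θ => (sin θ ^ 2) ^ 0) (by fun_prop)
    (fun _ => by positivity) pi_div_four_mem (by simp)

lemma sinMoment_one_lt (d : ℕ) (η : ℝ) : sinMoment d 1 η < sinMoment d 0 η := by
  have := integral_weight_pos d η (f := fun θ => cos θ ^ 2) (by fun_prop)
    (fun _ => by positivity) pi_div_four_mem (by rw [cos_pi_div_four]; positivity)
  have h := sinMoment_sub d 0 η
  rw [← sub_pos, ← h]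
  convert this using 3
  ring

lemma sinMoment_two_lt (d : ℕ) (η : ℝ) : sinMoment d 2 η < sinMoment d 1 η := by
  have := integral_weight_pos d η (f := fun θ => sin θ ^ 2 * cos θ ^ 2) (by fun_prop)
    (fun _ => by positivity) pi_div_four_mem (by
      rw [cos_pi_div_four, sin_pi_div_four]; positivity)
  have h := sinMoment_sub d 1 η
  rw [← sub_pos, ← h]
  convert this using 3
  ring

lemma sinMoment_variance_pos (d : ℕ) (η a : ℝ) :
    0 < sinMoment d 2 η - 2 * a * sinMoment d 1 η + a ^ 2 * sinMoment d 0 η := by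
  -- Strict positivity needs one angle where sin² differs from a: π/4 has sin² = 1/2, and π/6 serves
  -- when a = 1/2.
  have : ∃ c ∈ Set.Ioo 0 (π / 2), sin c ^ 2 ≠ a := by
    by_cases h : a = 1 / 2
    · refine ⟨π / 6, ⟨by positivity, by linarith [pi_pos]⟩, ?_⟩
      rw [sin_pi_div_six, h]; norm_num
    · refine ⟨π / 4, pi_div_four_mem, ?_⟩
      rw [sin_pi_div_four, div_pow, sq_sqrt (by norm_num)]
      intro h'
      exact h (by rw [← h']; norm_num)
  obtain ⟨c, hc, hca⟩ := this
  have h := integral_weight_pos d η (f := fun θ => (sin θ ^ 2 - a) ^ 2) (by fun_prop)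
    (fun _ => by positivity) hc (by have := sub_ne_zero.2 hca; positivity)
  convert h using 1
  unfold sinMoment
  rw [← intervalIntegral.integral_const_mul, ← intervalIntegral.integral_const_mul,
    ← intervalIntegral.integral_sub (Continuous.intervalIntegrable (by fun_prop) _ _)
    (Continuous.intervalIntegrable (by fun_prop) _ _),
    ← intervalIntegral.integral_add (Continuous.intervalIntegrable (by fun_prop) _ _)
    (Continuous.intervalIntegrable (by fun_prop) _ _)]
  refine intervalIntegral.integral_congr fun θ _ => ?_
  ring

/-! ### Unimodality of w and the minimum of σ₁. -/

/-- The average of `sin² θ` for the weight `e^{η sin² θ} cosᵈ θ`. -/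
def sinMean (d : ℕ) (η : ℝ) : ℝ := sinMoment d 1 η / sinMoment d 0 η

/-- The average of `sin² θ cos² θ` for the weight `e^{η sin² θ} cosᵈ θ`. -/
def sinCosMean (d : ℕ) (η : ℝ) : ℝ :=
  (sinMoment d 1 η - sinMoment d 2 η) / sinMoment d 0 η

lemma sinMean_lt_one (d : ℕ) (η : ℝ) : sinMean d η < 1 :=
  (div_lt_one (sinMoment_zero_pos d η)).2 (sinMoment_one_lt d η)

lemma sinCosMean_pos (d : ℕ) (η : ℝ) : 0 < sinCosMean d η :=
  div_pos (sub_pos.2 (sinMoment_two_lt d η)) (sinMoment_zero_pos d η)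

/-- The case k = 0 of `sinMoment_by_parts`. This relation also carries the Euler-Lagrange equation
of h_ν. -/
lemma sinCosMean_eq (d : ℕ) (η : ℝ) :
    2 * η * sinCosMean d η = (d + 2) * sinMean d η - 1 := by
  have h := sinMoment_by_parts d 0 η
  have h0 := (sinMoment_zero_pos d η).ne'
  unfold sinCosMean sinMean
  field_simp
  push_cast at h
  linarith

lemma sinVariance_pos (d : ℕ) (η : ℝ) :
    0 < sinMean d η - sinMean d η ^ 2 - sinCosMean d η := by
  have h := sinMoment_variance_pos d η (sinMean d η)
  have h0 := sinMoment_zero_pos d η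
  have : sinMean d η - sinMean d η ^ 2 - sinCosMean d η =
    (sinMoment d 2 η - 2 * sinMean d η * sinMoment d 1 η + sinMean d η ^ 2 * sinMoment d 0 η) /
      sinMoment d 0 η := by
    unfold sinCosMean sinMean
    field_simp
    ring
  rw [this]
  positivity

lemma hasDerivAt_sinMean (d : ℕ) (η : ℝ) :
    HasDerivAt (sinMean d) (sinMean d η - sinMean d η ^ 2 - sinCosMean d η) η := by
  have h0 := (sinMoment_zero_pos d η).ne'
  refine ((hasDerivAt_sinMoment d 1 η).div (hasDerivAt_sinMoment d 0 η) h0).congr_deriv ?_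
  unfold sinCosMean sinMean
  field_simp
  ring

lemma strictMono_sinMean (d : ℕ) : StrictMono (sinMean d) :=
  strictMono_of_hasDerivAt_pos (hasDerivAt_sinMean d) (sinVariance_pos d)

lemma differentiable_sinCosMean (d : ℕ) : Differentiable ℝ (sinCosMean d) := fun η =>
  (((hasDerivAt_sinMoment d 1 η).sub (hasDerivAt_sinMoment d 2 η)).div (hasDerivAt_sinMoment d 0 η)
    (sinMoment_zero_pos d η).ne').differentiableAt

/-- The function `2 η w'(η)`, where `w` is `sinCosMean`. -/
def sinSlope (d : ℕ) (η : ℝ) : ℝ :=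
  (d + 2) * (sinMean d η * (1 - sinMean d η)) - (d + 4) * sinCosMean d η

/-- Differentiating `sinCosMean_eq`, instead of w itself, keeps the third moment out of the formula.
-/
lemma deriv_sinCosMean (d : ℕ) (η : ℝ) :
    2 * η * deriv (sinCosMean d) η = sinSlope d η := by
  have h1 : HasDerivAt (fun η => 2 * η * sinCosMean d η)
      (2 * 1 * sinCosMean d η + 2 * η * deriv (sinCosMean d) η) η :=
    ((hasDerivAt_id η).const_mul 2).mul (differentiable_sinCosMean d η).hasDerivAt
  rw [funext (sinCosMean_eq d)] at h1
  have h2 := h1.unique (((hasDerivAt_sinMean d η).const_mul ((d : ℝ) + 2)).sub_const 1)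
  unfold sinSlope
  linarith

lemma hasDerivAt_sinSlope (d : ℕ) (η : ℝ) :
    ∃ p, HasDerivAt (sinSlope d) p η ∧ 2 * η * p + (d + 4) * sinSlope d η =
      2 * η * ((d + 2) * (sinMean d η - sinMean d η ^ 2 - sinCosMean d η) *
        (1 - 2 * sinMean d η)) := by
  have ha := hasDerivAt_sinMean d η
  refine ⟨_, ((ha.mul (ha.const_sub 1)).const_mul ((d : ℝ) + 2)).sub
    ((differentiable_sinCosMean d η).hasDerivAt.const_mul ((d : ℝ) + 4)), ?_⟩
  rw [← deriv_sinCosMean]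
  ring

/-- `sinSlope` along `ε s²`, with an integrating factor. -/
lemma hasDerivAt_pow_mul_sinSlope (d : ℕ) (ε s : ℝ) :
    HasDerivAt (fun s => s ^ (d + 4) * sinSlope d (ε * s ^ 2))
      (s ^ (d + 3) * (2 * (ε * s ^ 2) * ((d + 2) * (sinMean d (ε * s ^ 2) -
        sinMean d (ε * s ^ 2) ^ 2 - sinCosMean d (ε * s ^ 2)) *
          (1 - 2 * sinMean d (ε * s ^ 2))))) s := by
  obtain ⟨p, hp, he⟩ := hasDerivAt_sinSlope d (ε * s ^ 2)
  have h1 : HasDerivAt (fun s : ℝ => ε * s ^ 2) (ε * (2 * s)) s := by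
    simpa using ((hasDerivAt_pow 2 s).const_mul ε)
  have h2 := (hasDerivAt_pow (d + 4) s).mul (hp.comp s h1)
  -- With η = εs², the left side of the equation for S is multiplied by sᵈ⁺³ and becomes an exact
  -- derivative; ε = ±1 selects the half-line.
  refine h2.congr_deriv ?_
  rw [← he]
  simp only [Function.comp, show d + 4 - 1 = d + 3 by omega]
  push_cast
  ring

lemma sinMean_zero (d : ℕ) : sinMean d 0 = 1 / (d + 2) := by
  have h := sinCosMean_eq d 0
  field_simp
  linarith

lemma sinMean_zero_le (d : ℕ) : sinMean d 0 ≤ 1 / 2 := by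
  rw [sinMean_zero]
  exact one_div_le_one_div_of_le (by norm_num) (by linarith [(Nat.cast_nonneg d : (0 : ℝ) ≤ d)])

lemma continuous_pow_mul_sinSlope (d : ℕ) (ε : ℝ) :
    Continuous (fun s => s ^ (d + 4) * sinSlope d (ε * s ^ 2)) :=
  continuous_iff_continuousAt.2 fun s => (hasDerivAt_pow_mul_sinSlope d ε s).continuousAt

/-- For η < 0 the mean is below its value 1/(d + 2) ≤ 1/2 at 0, so sᵈ⁺⁴S(-s²) decreases from 0. -/
lemma sinSlope_neg_of_neg (d : ℕ) {η : ℝ} (hη : η < 0) : sinSlope d η < 0 := by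
  have hanti : StrictAntiOn (fun s => s ^ (d + 4) * sinSlope d (-1 * s ^ 2)) (Set.Ici 0) := by
    refine strictAntiOn_of_hasDerivWithinAt_neg (convex_Ici 0)
      (continuous_pow_mul_sinSlope d (-1)).continuousOn
      (fun s _ => (hasDerivAt_pow_mul_sinSlope d (-1) s).hasDerivWithinAt) fun s hs => ?_
    rw [interior_Ici, Set.mem_Ioi] at hs
    have h1 := sinVariance_pos d (-1 * s ^ 2)
    have h2 : sinMean d (-1 * s ^ 2) < 1 / 2 :=
      (strictMono_sinMean d (by nlinarith)).trans_le (sinMean_zero_le d)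
    refine mul_neg_of_pos_of_neg (by positivity) (mul_neg_of_neg_of_pos (by nlinarith) ?_)
    have h3 : 0 < 1 - 2 * sinMean d (-1 * s ^ 2) := by linarith
    positivity
  have hs : 0 < √(-η) := sqrt_pos.2 (by linarith)
  have h := hanti Set.self_mem_Ici hs.le hs
  have e : -1 * √(-η) ^ 2 = η := by rw [sq_sqrt (by linarith)]; ring
  simp only [e] at h
  rw [zero_pow (by omega), zero_mul] at h
  exact neg_of_mul_neg_right h (by positivity)

/-- While the mean stays below 1/2, the function sᵈ⁺⁴S(s²) increases from 0. -/
lemma sinSlope_pos_of_mean_le (d : ℕ) {η : ℝ} (hη : 0 < η) (ha : sinMean d η ≤ 1 / 2) :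
    0 < sinSlope d η := by
  have hmono : StrictMonoOn (fun s => s ^ (d + 4) * sinSlope d (1 * s ^ 2)) (Set.Icc 0 (√η)) := by
    refine strictMonoOn_of_hasDerivWithinAt_pos (convex_Icc _ _)
      (continuous_pow_mul_sinSlope d 1).continuousOn
      (fun s _ => (hasDerivAt_pow_mul_sinSlope d 1 s).hasDerivWithinAt) fun s hs => ?_
    rw [interior_Icc] at hs
    have hs0 := hs.1
    have h1 := sinVariance_pos d (1 * s ^ 2)
    have h2 : sinMean d (1 * s ^ 2) < 1 / 2 := by
      refine (strictMono_sinMean d ?_).trans_le ha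
      rw [one_mul]
      exact (lt_sqrt hs0.le).1 hs.2
    have h3 : 0 < 1 - 2 * sinMean d (1 * s ^ 2) := by linarith
    positivity
  have hs : 0 < √η := sqrt_pos.2 hη
  have h := hmono (Set.left_mem_Icc.2 hs.le) (Set.right_mem_Icc.2 hs.le) hs
  have e : 1 * √η ^ 2 = η := by rw [sq_sqrt hη.le, one_mul]
  simp only [e] at h
  rw [zero_pow (by omega), zero_mul] at h
  exact pos_of_mul_pos_right h (by positivity)

/-- A nonpositive slope at x > 0 forces a(x) > 1/2 by the previous lemma. As a increases, sᵈ⁺⁴S(s²)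
strictly decreases from √x on, so S cannot recover. -/
lemma sinSlope_neg_of_nonpos (d : ℕ) {x y : ℝ} (hx : 0 < x) (hxy : x < y)
    (h : sinSlope d x ≤ 0) : sinSlope d y < 0 := by
  have ha : 1 / 2 < sinMean d x := by
    by_contra! hc
    exact absurd (sinSlope_pos_of_mean_le d hx hc) (by linarith)
  have hanti : StrictAntiOn (fun s => s ^ (d + 4) * sinSlope d (1 * s ^ 2)) (Set.Ici (√x)) := by
    refine strictAntiOn_of_hasDerivWithinAt_neg (convex_Ici _)
      (continuous_pow_mul_sinSlope d 1).continuousOn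
      (fun s _ => (hasDerivAt_pow_mul_sinSlope d 1 s).hasDerivWithinAt) fun s hs => ?_
    rw [interior_Ici, Set.mem_Ioi] at hs
    have hs0 : 0 < s := (sqrt_pos.2 hx).trans hs
    have h1 := sinVariance_pos d (1 * s ^ 2)
    have h2 : 1 / 2 < sinMean d (1 * s ^ 2) := by
      refine ha.trans (strictMono_sinMean d ?_)
      rw [one_mul]
      exact (sqrt_lt' hs0).1 hs
    refine mul_neg_of_pos_of_neg (by positivity) (mul_neg_of_pos_of_neg (by positivity) ?_)
    exact mul_neg_of_pos_of_neg (by positivity) (by linarith)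
  have hs : 0 < √x := sqrt_pos.2 hx
  have hlt : √x < √y := sqrt_lt_sqrt hx.le hxy
  have h' := hanti Set.self_mem_Ici hlt.le hlt
  have e : ∀ z, 0 < z → 1 * √z ^ 2 = z := fun z hz => by rw [sq_sqrt hz.le, one_mul]
  simp only [e x hx, e y (hx.trans hxy)] at h'
  have h2 : √x ^ (d + 4) * sinSlope d x ≤ 0 := mul_nonpos_of_nonneg_of_nonpos (by positivity) h
  exact neg_of_mul_neg_right (h'.trans_le h2) (by positivity)

lemma deriv_sinCosMean_pos_of_neg (d : ℕ) {η : ℝ} (hη : η < 0) : 0 < deriv (sinCosMean d) η := by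
  have h := deriv_sinCosMean d η
  have h2 := sinSlope_neg_of_neg d hη
  by_contra! hc
  nlinarith

lemma strictMonoOn_sinCosMean (d : ℕ) : StrictMonoOn (sinCosMean d) (Set.Iic 0) :=
  strictMonoOn_of_deriv_pos (convex_Iic 0) (differentiable_sinCosMean d).continuous.continuousOn
    fun x hx => deriv_sinCosMean_pos_of_neg d (by simpa using hx)

lemma exists_sinCosMean_max (d : ℕ) : ∃ x, 0 ≤ x ∧ ∀ y, sinCosMean d y ≤ sinCosMean d x := by
  have hw := sinCosMean_pos d 0
  -- Since a < 1, the relation 2ηw = (d + 2)a - 1 gives 2ηw < d + 1, so w falls below w(0) for η >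
  -- R.
  set R := ((d : ℝ) + 1) / (2 * sinCosMean d 0) with hR
  have hR0 : 0 < R := by positivity
  obtain ⟨x, hx, hmax⟩ := isCompact_Icc.exists_isMaxOn (s := Set.Icc 0 R) ⟨0, le_refl _, hR0.le⟩
    (differentiable_sinCosMean d).continuous.continuousOn
  have h0 : sinCosMean d 0 ≤ sinCosMean d x := hmax ⟨le_refl _, hR0.le⟩
  refine ⟨x, hx.1, fun y => ?_⟩
  rcases lt_or_ge y 0 with hy | hy
  · exact (strictMonoOn_sinCosMean d hy.le Set.self_mem_Iic hy).le.trans h0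
  rcases le_or_gt y R with hyR | hyR
  · exact hmax ⟨hy, hyR⟩
  · refine le_trans ?_ h0
    have h1 := sinCosMean_eq d y
    have h2 := sinMean_lt_one d y
    have h3 : R * (2 * sinCosMean d 0) = d + 1 := by rw [hR]; field_simp
    by_contra! hc
    have : R * sinCosMean d 0 < y * sinCosMean d y := mul_lt_mul'' hyR hc hR0.le hw.le
    have h4 : ((d : ℝ) + 2) * sinMean d y < d + 2 := by
      have : (0 : ℝ) ≤ d := d.cast_nonneg
      nlinarith
    linarith

lemma sinSlope_neg_of_max (d : ℕ) {x y : ℝ} (hx : 0 ≤ x)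
    (hmax : ∀ y, sinCosMean d y ≤ sinCosMean d x) (hxy : x < y) : sinSlope d y < 0 := by
  rcases hx.eq_or_lt with rfl | hx
  -- At the maximizer 0 the factor η hides w'. If S(y) were nonnegative, S would be positive on (0,
  -- y), and w would increase there, against maximality at 0.
  · by_contra! hc
    have hpos : ∀ z, 0 < z → z < y → 0 < sinSlope d z := fun z hz hzy => by
      by_contra! h
      exact absurd (sinSlope_neg_of_nonpos d hz hzy h) (by linarith)
    have hmono : StrictMonoOn (sinCosMean d) (Set.Icc 0 y) := by
      refine strictMonoOn_of_deriv_pos (convex_Icc _ _)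
        (differentiable_sinCosMean d).continuous.continuousOn fun z hz => ?_
      rw [interior_Icc] at hz
      have h := deriv_sinCosMean d z
      exact pos_of_mul_pos_right (h.symm ▸ hpos z hz.1 hz.2) (by linarith [hz.1])
    exact absurd (hmono (Set.left_mem_Icc.2 hxy.le) (Set.right_mem_Icc.2 hxy.le) hxy)
      (not_lt.2 (hmax y))
  · refine sinSlope_neg_of_nonpos d hx hxy ?_
    have h0 : deriv (sinCosMean d) x = 0 :=
      IsLocalMax.deriv_eq_zero (Filter.Eventually.of_forall hmax)
    rw [← deriv_sinCosMean, h0, mul_zero]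

lemma sinCosMean_strict_of_max (d : ℕ) {x y : ℝ} (hx : 0 ≤ x)
    (hmax : ∀ y, sinCosMean d y ≤ sinCosMean d x) (hxy : x < y) :
    sinCosMean d y < sinCosMean d x := by
  have hanti : StrictAntiOn (sinCosMean d) (Set.Icc x y) := by
    refine strictAntiOn_of_deriv_neg (convex_Icc _ _)
      (differentiable_sinCosMean d).continuous.continuousOn fun z hz => ?_
    rw [interior_Icc] at hz
    have h := deriv_sinCosMean d z
    have h2 := sinSlope_neg_of_max d hx hmax hz.1
    rw [← h] at h2
    exact neg_of_mul_neg_right h2 (by linarith [hz.1])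
  exact hanti (Set.left_mem_Icc.2 hxy.le) (Set.right_mem_Icc.2 hxy.le) hxy

/-- For uniqueness, the smaller of two nonnegative maximizers would have w strictly decreasing to
its right, contradicting the larger one; negative maximizers are excluded by monotonicity. -/
lemma exists_sinCosMean_strict_max (d : ℕ) : ∃ x, 0 ≤ x ∧
    (∀ y, y ≠ x → sinCosMean d y < sinCosMean d x) ∧ ∀ y, x < y → sinSlope d y < 0 := by
  obtain ⟨x, hx, hmax⟩ := exists_sinCosMean_max d
  refine ⟨x, hx, fun y hy => (hmax y).lt_of_ne fun he => ?_,
    fun y => sinSlope_neg_of_max d hx hmax⟩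
  rcases lt_or_gt_of_ne hy with h | h
  · rcases lt_or_ge y 0 with hy0 | hy0
    · have := strictMonoOn_sinCosMean d hy0.le Set.self_mem_Iic hy0
      linarith [hmax 0]
    · have := sinCosMean_strict_of_max d hy0 (fun z => he ▸ hmax z) h
      linarith
  · have := sinCosMean_strict_of_max d hx hmax h
    linarith

lemma sigma_one_eq (d : ℕ) (η : ℝ) : sigma (d + 2) 1 η = (d + 1) / (2 * sinCosMean d η) := by
  have h0 := sinMoment_zero_pos d η
  have h1 := sinMoment_two_lt d η
  have e1 : ∫ θ in (0 : ℝ)..π / 2, exp (η * sin θ ^ 2) *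
      (sin θ ^ (1 - 1) * cos θ ^ (d + 2 - 1 - 1)) = sinMoment d 0 η := by
    unfold sinMoment
    simp
  have e2 : ∫ θ in (0 : ℝ)..π / 2, exp (η * sin θ ^ 2) * sin θ ^ 2 * cos θ ^ 2 *
      (sin θ ^ (1 - 1) * cos θ ^ (d + 2 - 1 - 1)) = sinMoment d 1 η - sinMoment d 2 η := by
    rw [← sinMoment_sub]
    refine intervalIntegral.integral_congr fun θ _ => ?_
    simp only [show d + 2 - 1 - 1 = d by omega, Nat.sub_self]
    ring
  unfold sigma
  rw [e1, e2, sinCosMean]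
  have h2 : sinMoment d 1 η - sinMoment d 2 η ≠ 0 := by linarith
  push_cast
  field_simp
  ring

/-! ### Rotation invariance and integration by parts on the sphere. -/

/-- The action of a linear isometry on the unit sphere. -/
def sphMap {n : ℕ} (e : EuclideanSpace ℝ (Fin n) ≃ₗᵢ[ℝ] EuclideanSpace ℝ (Fin n)) (m : Sph n) :
    Sph n := ⟨e m, by simp⟩

@[simp] lemma coe_sphMap {n : ℕ} (e : EuclideanSpace ℝ (Fin n) ≃ₗᵢ[ℝ] EuclideanSpace ℝ (Fin n))
    (m : Sph n) : (sphMap e m : EuclideanSpace ℝ (Fin n)) = e m := rfl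

lemma continuous_sphMap {n : ℕ} (e : EuclideanSpace ℝ (Fin n) ≃ₗᵢ[ℝ] EuclideanSpace ℝ (Fin n)) :
    Continuous (sphMap e) :=
  (e.continuous.comp continuous_subtype_val).subtype_mk _

/-- The surface measure of a set is, up to a constant, the volume of the cone over it. A linear
isometry commutes with scaling, so it maps cones to cones, and it preserves volume. -/
lemma measurePreserving_sphMap {n : ℕ}
    (e : EuclideanSpace ℝ (Fin n) ≃ₗᵢ[ℝ] EuclideanSpace ℝ (Fin n)) :
    MeasurePreserving (sphMap e) (surf n) (surf n) := by
  have hmp : MeasurePreserving e.toMeasurableEquiv volume volume := e.measurePreserving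
  refine ⟨(continuous_sphMap e).measurable, Measure.ext fun s hs => ?_⟩
  rw [Measure.map_apply (continuous_sphMap e).measurable hs,
    Measure.toSphere_apply' _ ((continuous_sphMap e).measurable hs), Measure.toSphere_apply' _ hs]
  congr 1
  refine Eq.trans ?_ (hmp.measure_preimage_equiv _)
  congr 1
  ext x
  simp only [Set.mem_smul, Set.mem_image, Set.mem_preimage]
  constructor
  · rintro ⟨r, hr, _, ⟨m, hm, rfl⟩, rfl⟩
    exact ⟨r, hr, _, ⟨_, hm, rfl⟩, by simp⟩
  · rintro ⟨r, hr, _, ⟨m, hm, rfl⟩, h⟩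
    refine ⟨r, hr, _, ⟨sphMap e.symm m, ?_, rfl⟩, ?_⟩
    · have : sphMap e (sphMap e.symm m) = m := by ext1; simp
      simpa [this] using hm
    · apply e.injective
      rw [map_smul]
      simpa using h

lemma integral_comp_sphMap {n : ℕ}
    (e : EuclideanSpace ℝ (Fin n) ≃ₗᵢ[ℝ] EuclideanSpace ℝ (Fin n)) {f : Sph n → ℝ}
    (hf : Continuous f) : ∫ m, f (sphMap e m) ∂(surf n) = ∫ m, f m ∂(surf n) := by
  have h := measurePreserving_sphMap e
  rw [← h.map_eq, integral_map h.aemeasurable hf.aestronglyMeasurable, h.map_eq]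

lemma integrable_of_continuous {n : ℕ} {f : Sph n → ℝ} (hf : Continuous f) :
    Integrable f (surf n) :=
  hf.integrable_of_hasCompactSupport (HasCompactSupport.of_compactSpace _)

lemma integral_eq_zero_of_odd {n : ℕ}
    (e : EuclideanSpace ℝ (Fin n) ≃ₗᵢ[ℝ] EuclideanSpace ℝ (Fin n)) {f : Sph n → ℝ}
    (hf : Continuous f) (h : ∀ m, f (sphMap e m) = -f m) : ∫ m, f m ∂(surf n) = 0 := by
  have := integral_comp_sphMap e hf
  simp only [h, integral_neg] at this
  linarith

section Rotation

variable {E : Type*} [NormedAddCommGroup E] [InnerProductSpace ℝ E]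

/-- The rotation by the angle `s` in the plane of the orthonormal vectors `u` and `v`. -/
def rot (u v : E) (s : ℝ) (m : E) : E :=
  m + ((cos s - 1) * ⟪u, m⟫ - sin s * ⟪v, m⟫) • u + ((cos s - 1) * ⟪v, m⟫ + sin s * ⟪u, m⟫) • v

lemma norm_rot {u v : E} (hu : ‖u‖ = 1) (hv : ‖v‖ = 1) (huv : ⟪u, v⟫ = 0) (s : ℝ) (m : E) :
    ‖rot u v s m‖ = ‖m‖ := by
  have huu : ⟪u, u⟫ = 1 := by rw [real_inner_self_eq_norm_sq, hu, one_pow]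
  have hvv : ⟪v, v⟫ = 1 := by rw [real_inner_self_eq_norm_sq, hv, one_pow]
  have hvu : ⟪v, u⟫ = 0 := by rw [real_inner_comm, huv]
  rw [← sq_eq_sq₀ (norm_nonneg _) (norm_nonneg _), ← real_inner_self_eq_norm_sq,
    ← real_inner_self_eq_norm_sq]
  simp only [rot, inner_add_left, inner_add_right, real_inner_smul_left, real_inner_smul_right,
    huu, hvv, huv, hvu, real_inner_comm u m, real_inner_comm v m]
  linear_combination (⟪u, m⟫ ^ 2 + ⟪v, m⟫ ^ 2) * sin_sq_add_cos_sq s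

lemma inner_rot_left {u v : E} (hu : ‖u‖ = 1) (huv : ⟪u, v⟫ = 0) (s : ℝ) (m : E) :
    ⟪u, rot u v s m⟫ = cos s * ⟪u, m⟫ - sin s * ⟪v, m⟫ := by
  have huu : ⟪u, u⟫ = 1 := by rw [real_inner_self_eq_norm_sq, hu, one_pow]
  simp only [rot, inner_add_right, real_inner_smul_right, huu, huv]
  ring

lemma inner_rot_right {u v : E} (hv : ‖v‖ = 1) (huv : ⟪u, v⟫ = 0) (s : ℝ) (m : E) :
    ⟪v, rot u v s m⟫ = cos s * ⟪v, m⟫ + sin s * ⟪u, m⟫ := by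
  have hvv : ⟪v, v⟫ = 1 := by rw [real_inner_self_eq_norm_sq, hv, one_pow]
  simp only [rot, inner_add_right, real_inner_smul_right, hvv, real_inner_comm u v ▸ huv]
  ring

lemma hasDerivAt_rot {u v : E} (hu : ‖u‖ = 1) (hv : ‖v‖ = 1) (huv : ⟪u, v⟫ = 0) (s : ℝ) (m : E) :
    HasDerivAt (fun s => rot u v s m)
      (⟪u, rot u v s m⟫ • v - ⟪v, rot u v s m⟫ • u) s := by
  have h1 := (((hasDerivAt_cos s).sub_const 1).mul_const ⟪u, m⟫).sub
    ((hasDerivAt_sin s).mul_const ⟪v, m⟫)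
  have h2 := (((hasDerivAt_cos s).sub_const 1).mul_const ⟪v, m⟫).add
    ((hasDerivAt_sin s).mul_const ⟪u, m⟫)
  refine (((hasDerivAt_const s m).add (h1.smul_const u)).add (h2.smul_const v)).congr_deriv ?_
  rw [inner_rot_left hu huv, inner_rot_right hv huv]
  module

lemma exists_linearIsometryEquiv_rot [FiniteDimensional ℝ E] {u v : E} (hu : ‖u‖ = 1)
    (hv : ‖v‖ = 1) (huv : ⟪u, v⟫ = 0) (s : ℝ) : ∃ e : E ≃ₗᵢ[ℝ] E, ∀ m, e m = rot u v s m := by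
  let L : E →ₗᵢ[ℝ] E :=
    { toFun := rot u v s
      map_add' := fun x y => by simp only [rot, inner_add_right]; module
      map_smul' := fun c x => by
        simp only [rot, real_inner_smul_right, RingHom.id_apply]; module
      norm_map' := norm_rot hu hv huv s }
  exact ⟨L.toLinearIsometryEquiv rfl, fun m => rfl⟩

end Rotation

/-- Integration by parts on the sphere, for the generator of a rotation. -/
lemma integral_rotation_generator {n : ℕ} {f : EuclideanSpace ℝ (Fin n) → ℝ}
    (hf : ContDiff ℝ 1 f) {u v : EuclideanSpace ℝ (Fin n)} (hu : ‖u‖ = 1) (hv : ‖v‖ = 1)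
    (huv : ⟪u, v⟫ = 0) :
    ∫ m : Sph n, (⟪u, (m : EuclideanSpace ℝ (Fin n))⟫ * fderiv ℝ f m v -
      ⟪v, (m : EuclideanSpace ℝ (Fin n))⟫ * fderiv ℝ f m u) ∂(surf n) = 0 := by
  set g : EuclideanSpace ℝ (Fin n) → ℝ := fun x => fderiv ℝ f x (⟪u, x⟫ • v - ⟪v, x⟫ • u) with hg
  have hgc : Continuous g := by
    have h1 := hf.continuous_fderiv one_ne_zero
    fun_prop
  obtain ⟨C, hC⟩ := ((isCompact_sphere (0 : EuclideanSpace ℝ (Fin n)) 1).image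
    hgc).isBounded.exists_norm_le
  have hsph : ∀ s (m : Sph n), rot u v s (m : EuclideanSpace ℝ (Fin n)) ∈
      Metric.sphere (0 : EuclideanSpace ℝ (Fin n)) 1 := fun s m => by
    rw [mem_sphere_zero_iff_norm, norm_rot hu hv huv, norm_eq_of_mem_sphere]
  have hrot : ∀ s, Continuous fun m : Sph n => rot u v s (m : EuclideanSpace ℝ (Fin n)) :=
    fun s => by unfold rot; fun_prop
  have key := (hasDerivAt_integral_of_dominated_loc_of_deriv_le (μ := surf n) (x₀ := (0 : ℝ))
    (F := fun s (m : Sph n) => f (rot u v s m)) (F' := fun s (m : Sph n) => g (rot u v s m))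
    (bound := fun _ => C) (Metric.ball_mem_nhds 0 one_pos)
    (Filter.Eventually.of_forall fun s => (hf.continuous.comp (hrot s)).aestronglyMeasurable)
    (integrable_of_continuous (hf.continuous.comp (hrot 0)))
    (hgc.comp (hrot 0)).aestronglyMeasurable
    (Filter.Eventually.of_forall fun m s _ => hC _ ⟨_, hsph s m, rfl⟩) (integrable_const C)
    (Filter.Eventually.of_forall fun m s _ =>
      ((hf.differentiable one_ne_zero _).hasFDerivAt.comp_hasDerivAt s
        (hasDerivAt_rot hu hv huv s (m : EuclideanSpace ℝ (Fin n)))))).2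
  -- By invariance the integral of f over the rotated sphere does not depend on s, so its derivative
  -- at s = 0, computed in `key`, vanishes.
  have hconst : (fun s => ∫ m : Sph n, f (rot u v s m) ∂(surf n)) =
      fun _ => ∫ m : Sph n, f m ∂(surf n) := by
    funext s
    obtain ⟨e, he⟩ := exists_linearIsometryEquiv_rot hu hv huv s
    rw [← integral_comp_sphMap e (f := fun m => f m) (hf.continuous.comp continuous_subtype_val)]
    simp [he]
  rw [hconst] at key
  rw [← key.unique (hasDerivAt_const _ _)]
  refine integral_congr_ae (Filter.Eventually.of_forall fun m => ?_)
  simp [hg, rot]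

/-! ### Moments in coordinates adapted to an axis. -/

section Coordinates

/-- The Euclidean space of dimension `d + 2`. -/
abbrev Euc (d : ℕ) : Type := EuclideanSpace ℝ (Fin (d + 2))

variable {d : ℕ} (b : OrthonormalBasis (Fin (d + 2)) ℝ (Euc d))

lemma sum_inner_succ_sq (m : Sph (d + 2)) :
    ∑ i : Fin (d + 1), ⟪b i.succ, (m : Euc d)⟫ ^ 2 = 1 - ⟪b 0, (m : Euc d)⟫ ^ 2 := by
  have h := b.sum_sq_norm_inner_right (m : Euc d)
  rw [norm_eq_of_mem_sphere, Fin.sum_univ_succ] at h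
  simp only [norm_eq_abs, sq_abs] at h
  linarith

lemma integral_rotation_generator_basis (i j : Fin (d + 2)) {f : Euc d → ℝ}
    (hf : ContDiff ℝ 1 f) :
    ∫ m : Sph (d + 2), (⟪b i, (m : Euc d)⟫ * fderiv ℝ f m (b j) -
      ⟪b j, (m : Euc d)⟫ * fderiv ℝ f m (b i)) ∂(surf (d + 2)) = 0 := by
  by_cases h : i = j
  · simp [h]
  · exact integral_rotation_generator hf (b.norm_eq_one i) (b.norm_eq_one j)
      (b.inner_eq_zero h)

lemma contDiff_inner_basis (i : Fin (d + 2)) : ContDiff ℝ 1 fun m : Euc d => ⟪b i, m⟫ :=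
  (innerSL ℝ (b i)).contDiff

lemma hasFDerivAt_inner_basis (i : Fin (d + 2)) (m : Euc d) :
    HasFDerivAt (fun m : Euc d => ⟪b i, m⟫) (innerSL ℝ (b i)) m :=
  (innerSL ℝ (b i)).hasFDerivAt

/-- Sum over j of the rotation identities in the planes of bᵢ₊₁ and bⱼ₊₁, applied to yⱼp. If p =
G(x)q(y) with q homogeneous of degree k, Euler's relation turns the first two terms into (d + k)yᵢp,
so the degree of the moment drops by two. -/
lemma integral_inner_mul_perp (i : Fin (d + 1)) {p : Euc d → ℝ} (hp : ContDiff ℝ 1 p) :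
    ∫ m : Sph (d + 2), (d * (⟪b i.succ, (m : Euc d)⟫ * p m) +
      ⟪b i.succ, (m : Euc d)⟫ * ∑ j : Fin (d + 1),
        ⟪b j.succ, (m : Euc d)⟫ * fderiv ℝ p m (b j.succ) -
      (1 - ⟪b 0, (m : Euc d)⟫ ^ 2) * fderiv ℝ p m (b i.succ)) ∂(surf (d + 2)) = 0 := by
  have hpf := hp.continuous_fderiv one_ne_zero
  have hc : ∀ j : Fin (d + 1), ContDiff ℝ 1 (fun m : Euc d => ⟪b j.succ, m⟫ * p m) :=
    fun j => (contDiff_inner_basis b _).mul hp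
  have h : ∑ j : Fin (d + 1), ∫ m : Sph (d + 2), (⟪b i.succ, (m : Euc d)⟫ *
      fderiv ℝ (fun m : Euc d => ⟪b j.succ, m⟫ * p m) m (b j.succ) - ⟪b j.succ, (m : Euc d)⟫ *
      fderiv ℝ (fun m : Euc d => ⟪b j.succ, m⟫ * p m) m (b i.succ)) ∂(surf (d + 2)) = 0 :=
    Finset.sum_eq_zero fun j _ => integral_rotation_generator_basis b i.succ j.succ (hc j)
  rw [← integral_finsetSum _ fun j _ => integrable_of_continuous (by
    have := (hc j).continuous_fderiv one_ne_zero
    fun_prop)] at h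
  rw [← h]
  refine integral_congr_ae (Filter.Eventually.of_forall fun m => ?_)
  have hd : ∀ j k : Fin (d + 1),
      fderiv ℝ (fun m : Euc d => ⟪b j.succ, m⟫ * p m) m (b k.succ) =
        ⟪b j.succ, (m : Euc d)⟫ * fderiv ℝ p m (b k.succ) +
          (if j = k then 1 else 0) * p m := fun j k => by
    have e : fderiv ℝ (fun m : Euc d => ⟪b j.succ, m⟫ * p m) m = _ :=
      ((hasFDerivAt_inner_basis b j.succ (m : Euc d)).mul
        (hp.differentiable one_ne_zero _).hasFDerivAt).fderiv
    rw [e]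
    simp [orthonormal_iff_ite.1 b.orthonormal, mul_comm]
  have h1 := sum_inner_succ_sq b m
  simp only [hd, ← h1, Finset.sum_mul, Finset.mul_sum, Finset.sum_sub_distrib, mul_add,
    Finset.sum_add_distrib]
  simp
  have : ∀ j : Fin (d + 1), ⟪b j.succ, (m : Euc d)⟫ * (⟪b j.succ, (m : Euc d)⟫ *
    fderiv ℝ p m (b i.succ)) = ⟪b j.succ, (m : Euc d)⟫ ^ 2 * fderiv ℝ p m (b i.succ) :=
    fun j => by ring
  simp only [this]
  ring

/-- The rotation identity in the plane of b₀ and bᵢ₊₁, applied to x²ᵏ⁺¹yᵢ. -/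
lemma integral_rotation_moment (k : ℕ) (i : Fin (d + 1)) :
    ∫ m : Sph (d + 2), (⟪b 0, (m : Euc d)⟫ ^ (2 * k + 2) -
      (2 * k + 1) * ⟪b 0, (m : Euc d)⟫ ^ (2 * k) * ⟪b i.succ, (m : Euc d)⟫ ^ 2)
        ∂(surf (d + 2)) = 0 := by
  have hc : ContDiff ℝ 1 (fun m : Euc d => ⟪b 0, m⟫ ^ (2 * k + 1) * ⟪b i.succ, m⟫) :=
    ((contDiff_inner_basis b _).pow _).mul (contDiff_inner_basis b _)
  rw [← integral_rotation_generator_basis b 0 i.succ hc]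
  refine integral_congr_ae (Filter.Eventually.of_forall fun m => ?_)
  have e : fderiv ℝ (fun m : Euc d => ⟪b 0, m⟫ ^ (2 * k + 1) * ⟪b i.succ, m⟫) m = _ :=
    (((hasFDerivAt_inner_basis b 0 (m : Euc d)).pow (2 * k + 1)).mul
    (hasFDerivAt_inner_basis b i.succ (m : Euc d))).fderiv
  simp only [e]
  simp [orthonormal_iff_ite.1 b.orthonormal, (Fin.succ_ne_zero i).symm]
  ring

/-- Summation over i with Σ yᵢ² = 1 - x². The outcome is the recursion of `sinMoment_by_parts` at η
= 0. -/
lemma integral_moment_succ (k : ℕ) :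
    (d + 1) * ∫ m : Sph (d + 2), (⟪b 0, (m : Euc d)⟫ ^ 2) ^ (k + 1) ∂(surf (d + 2)) =
      (2 * k + 1) * (∫ m : Sph (d + 2), (⟪b 0, (m : Euc d)⟫ ^ 2) ^ k ∂(surf (d + 2)) -
        ∫ m : Sph (d + 2), (⟪b 0, (m : Euc d)⟫ ^ 2) ^ (k + 1) ∂(surf (d + 2))) := by
  have h := Finset.sum_eq_zero fun i (_ : i ∈ Finset.univ) => integral_rotation_moment b k i
  rw [← integral_finsetSum _ fun j _ => integrable_of_continuous (by fun_prop)] at h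
  simp only [Finset.sum_sub_distrib, ← Finset.mul_sum, sum_inner_succ_sq] at h
  rw [← sub_eq_zero, ← integral_sub (integrable_of_continuous (by fun_prop))
    (integrable_of_continuous (by fun_prop)), ← integral_const_mul, ← integral_const_mul,
    ← integral_sub (integrable_of_continuous (by fun_prop))
    (integrable_of_continuous (by fun_prop)), ← h]
  refine integral_congr_ae (Filter.Eventually.of_forall fun m => ?_)
  simp
  ring

end Coordinates

section Moments

variable {d : ℕ} (b : OrthonormalBasis (Fin (d + 2)) ℝ (Euc d))

lemma fderiv_axial_mul {G : ℝ → ℝ} (hG : ContDiff ℝ 1 G) {q : Euc d → ℝ} (hq : ContDiff ℝ 1 q)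
    (m : Euc d) (k : Fin (d + 1)) :
    fderiv ℝ (fun m : Euc d => G ⟪b 0, m⟫ * q m) m (b k.succ) =
      G ⟪b 0, m⟫ * fderiv ℝ q m (b k.succ) := by
  have e : fderiv ℝ (fun m : Euc d => G ⟪b 0, m⟫ * q m) m = _ :=
    (((hG.differentiable one_ne_zero _).hasDerivAt.comp_hasFDerivAt m
      (hasFDerivAt_inner_basis b 0 m)).mul (hq.differentiable one_ne_zero _).hasFDerivAt).fderiv
  rw [e]
  simp [orthonormal_iff_ite.1 b.orthonormal, (Fin.succ_ne_zero k).symm]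

lemma integral_perp_second_moment {G : ℝ → ℝ} (hG : ContDiff ℝ 1 G) (i j : Fin (d + 1)) :
    (d + 1) * ∫ m : Sph (d + 2), G ⟪b 0, (m : Euc d)⟫ *
        (⟪b i.succ, (m : Euc d)⟫ * ⟪b j.succ, (m : Euc d)⟫) ∂(surf (d + 2)) =
      (if i = j then 1 else 0) * ∫ m : Sph (d + 2), G ⟪b 0, (m : Euc d)⟫ *
        (1 - ⟪b 0, (m : Euc d)⟫ ^ 2) ∂(surf (d + 2)) := by
  have hGc := hG.continuous
  have hp : ContDiff ℝ 1 (fun m : Euc d => G ⟪b 0, m⟫ * ⟪b j.succ, m⟫) :=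
    (hG.comp (contDiff_inner_basis b 0)).mul (contDiff_inner_basis b j.succ)
  have h := integral_inner_mul_perp b i hp
  simp only [fderiv_axial_mul b hG (contDiff_inner_basis b j.succ),
    (hasFDerivAt_inner_basis b j.succ _).fderiv, innerSL_apply_apply,
    orthonormal_iff_ite.1 b.orthonormal, Fin.succ_inj] at h
  rw [← sub_eq_zero, ← integral_const_mul, ← integral_const_mul,
    ← integral_sub (integrable_of_continuous (by fun_prop))
    (integrable_of_continuous (by fun_prop))]
  refine (integral_congr_ae (Filter.Eventually.of_forall fun m => ?_)).trans h
  simp only [mul_ite, mul_one, mul_zero, Finset.sum_ite_eq, Finset.mem_univ, if_true,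
    eq_comm (a := j) (b := i)]
  split_ifs <;> ring

/-- Here q is cubic, which gives the factor d + 3; the derivative of q leaves second moments with
the weight G(x)(1 - x²), and these give the factor d + 1. -/
lemma integral_perp_fourth_moment {G : ℝ → ℝ} (hG : ContDiff ℝ 1 G) (i j k l : Fin (d + 1)) :
    ((d + 1) * (d + 3)) * ∫ m : Sph (d + 2), G ⟪b 0, (m : Euc d)⟫ *
        (⟪b i.succ, (m : Euc d)⟫ * (⟪b j.succ, (m : Euc d)⟫ *
          ⟪b k.succ, (m : Euc d)⟫ * ⟪b l.succ, (m : Euc d)⟫)) ∂(surf (d + 2)) =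
      ((if i = j then 1 else 0) * (if k = l then 1 else 0) +
        (if i = k then 1 else 0) * (if j = l then 1 else 0) +
        (if i = l then 1 else 0) * (if j = k then 1 else 0)) *
      ∫ m : Sph (d + 2), G ⟪b 0, (m : Euc d)⟫ * (1 - ⟪b 0, (m : Euc d)⟫ ^ 2) ^ 2
        ∂(surf (d + 2)) := by
  have hGc := hG.continuous
  have hq := ((contDiff_inner_basis b j.succ).mul (contDiff_inner_basis b k.succ)).mul
    (contDiff_inner_basis b l.succ)
  have hp : ContDiff ℝ 1 (fun m : Euc d => G ⟪b 0, m⟫ *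
      (⟪b j.succ, m⟫ * ⟪b k.succ, m⟫ * ⟪b l.succ, m⟫)) :=
    (hG.comp (contDiff_inner_basis b 0)).mul hq
  have h := integral_inner_mul_perp b i hp
  have e : ∀ (m : Euc d) (r : Fin (d + 1)), fderiv ℝ
      (fun m : Euc d => ⟪b j.succ, m⟫ * ⟪b k.succ, m⟫ * ⟪b l.succ, m⟫) m (b r.succ) =
      (if j = r then 1 else 0) * (⟪b k.succ, m⟫ * ⟪b l.succ, m⟫) +
        (if k = r then 1 else 0) * (⟪b j.succ, m⟫ * ⟪b l.succ, m⟫) +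
        (if l = r then 1 else 0) * (⟪b j.succ, m⟫ * ⟪b k.succ, m⟫) := fun m r => by
    have e : fderiv ℝ (fun m : Euc d => ⟪b j.succ, m⟫ * ⟪b k.succ, m⟫ * ⟪b l.succ, m⟫) m = _ :=
      (((hasFDerivAt_inner_basis b j.succ m).mul (hasFDerivAt_inner_basis b k.succ m)).mul
        (hasFDerivAt_inner_basis b l.succ m)).fderiv
    rw [e]
    simp [orthonormal_iff_ite.1 b.orthonormal]
    ring_nf
  simp only [fderiv_axial_mul b hG hq, e] at h
  have hG1 : ContDiff ℝ 1 fun x => G x * (1 - x ^ 2) := by fun_prop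
  have s1 := integral_perp_second_moment b hG1 k l
  have s2 := integral_perp_second_moment b hG1 j l
  have s3 := integral_perp_second_moment b hG1 j k
  have h3 : (d + 3) * ∫ m : Sph (d + 2), G ⟪b 0, (m : Euc d)⟫ *
        (⟪b i.succ, (m : Euc d)⟫ * (⟪b j.succ, (m : Euc d)⟫ *
          ⟪b k.succ, (m : Euc d)⟫ * ⟪b l.succ, (m : Euc d)⟫)) ∂(surf (d + 2)) =
      (if i = j then 1 else 0) * (∫ m : Sph (d + 2), G ⟪b 0, (m : Euc d)⟫ *
      (1 - ⟪b 0, (m : Euc d)⟫ ^ 2) * (⟪b k.succ, (m : Euc d)⟫ * ⟪b l.succ, (m : Euc d)⟫)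
        ∂(surf (d + 2))) +
      (if i = k then 1 else 0) * (∫ m : Sph (d + 2), G ⟪b 0, (m : Euc d)⟫ *
      (1 - ⟪b 0, (m : Euc d)⟫ ^ 2) * (⟪b j.succ, (m : Euc d)⟫ * ⟪b l.succ, (m : Euc d)⟫)
        ∂(surf (d + 2))) +
      (if i = l then 1 else 0) * (∫ m : Sph (d + 2), G ⟪b 0, (m : Euc d)⟫ *
      (1 - ⟪b 0, (m : Euc d)⟫ ^ 2) * (⟪b j.succ, (m : Euc d)⟫ * ⟪b k.succ, (m : Euc d)⟫)
        ∂(surf (d + 2))) := by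
    simp only [← integral_const_mul]
    rw [← sub_eq_zero, ← integral_add (integrable_of_continuous (by fun_prop))
        (integrable_of_continuous (by fun_prop)),
      ← integral_add (integrable_of_continuous (by fun_prop))
        (integrable_of_continuous (by fun_prop)),
      ← integral_sub (integrable_of_continuous (by fun_prop))
        (integrable_of_continuous (by fun_prop))]
    refine (integral_congr_ae (Filter.Eventually.of_forall fun m => ?_)).trans h
    simp only [mul_add, Finset.sum_add_distrib, ite_mul, one_mul, zero_mul, mul_ite, mul_zero,
      Finset.sum_ite_eq, Finset.mem_univ, if_true, eq_comm (b := i)]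
    split_ifs <;> ring
  rw [mul_assoc, h3]
  have hsq : ∫ m : Sph (d + 2), G ⟪b 0, (m : Euc d)⟫ * (1 - ⟪b 0, (m : Euc d)⟫ ^ 2) ^ 2
        ∂(surf (d + 2)) = ∫ m : Sph (d + 2), G ⟪b 0, (m : Euc d)⟫ *
        (1 - ⟪b 0, (m : Euc d)⟫ ^ 2) * (1 - ⟪b 0, (m : Euc d)⟫ ^ 2) ∂(surf (d + 2)) := by
    refine integral_congr_ae (Filter.Eventually.of_forall fun m => ?_)
    ring
  rw [hsq]
  linear_combination (if i = j then (1 : ℝ) else 0) * s1 + (if i = k then (1 : ℝ) else 0) * s2 +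
    (if i = l then (1 : ℝ) else 0) * s3

/-- The linear isometry that fixes `b 0` and is `-1` on its orthogonal complement. -/
lemma exists_perp_neg : ∃ e : Euc d ≃ₗᵢ[ℝ] Euc d, ∀ m : Euc d, ⟪b 0, e m⟫ = ⟪b 0, m⟫ ∧
    ∀ i : Fin (d + 1), ⟪b i.succ, e m⟫ = -⟪b i.succ, m⟫ := by
  refine ⟨(ℝ ∙ b 0).reflection, fun m => ⟨?_, fun i => ?_⟩⟩
  · rw [Submodule.reflection_singleton_apply]
    simp [inner_sub_right, two_smul, inner_add_right, inner_smul_right, b.norm_eq_one]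
  · rw [Submodule.reflection_singleton_apply]
    simp [inner_sub_right, two_smul, inner_add_right, inner_smul_right,
      orthonormal_iff_ite.1 b.orthonormal]

lemma integral_eq_zero_of_perp_odd {f : ℝ → (Fin (d + 1) → ℝ) → ℝ}
    (hf : Continuous fun m : Sph (d + 2) => f ⟪b 0, (m : Euc d)⟫ fun i => ⟪b i.succ, (m : Euc d)⟫)
    (h : ∀ x y, f x (fun i => -y i) = -f x y) :
    ∫ m : Sph (d + 2), f ⟪b 0, (m : Euc d)⟫ (fun i => ⟪b i.succ, (m : Euc d)⟫) ∂(surf (d + 2))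
      = 0 := by
  obtain ⟨e, he⟩ := exists_perp_neg b
  refine integral_eq_zero_of_odd e hf fun m => ?_
  simp only [coe_sphMap, (he _).1, (he _).2, h]

lemma integral_axial_pow (k : ℕ) :
    ∫ m : Sph (d + 2), (⟪b 0, (m : Euc d)⟫ ^ 2) ^ k ∂(surf (d + 2)) =
      (surf (d + 2)).real Set.univ / sinMoment d 0 0 * sinMoment d k 0 := by
  have h0 := (sinMoment_zero_pos d 0).ne'
  induction k with
  | zero => field_simp; simp
  | succ k ih =>
    have h1 := integral_moment_succ b k
    have h2 := sinMoment_by_parts d k 0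
    have hd : (0 : ℝ) < d + 1 + (2 * k + 1) := by positivity
    refine mul_left_cancel₀ hd.ne' ?_
    rw [ih] at h1
    linear_combination h1 + (surf (d + 2)).real Set.univ / sinMoment d 0 0 * h2

lemma integral_axial_polynomial (p : Polynomial ℝ) :
    ∫ m : Sph (d + 2), p.eval (⟪b 0, (m : Euc d)⟫ ^ 2) ∂(surf (d + 2)) =
      (surf (d + 2)).real Set.univ / sinMoment d 0 0 *
        ∫ θ in (0 : ℝ)..π / 2, p.eval (sin θ ^ 2) * cos θ ^ d := by
  simp only [Polynomial.eval_eq_sum_range]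
  rw [integral_finsetSum _ fun k _ => integrable_of_continuous (by fun_prop)]
  simp only [Finset.sum_mul]
  rw [intervalIntegral.integral_finsetSum fun k _ =>
    Continuous.intervalIntegrable (by fun_prop) _ _, Finset.mul_sum]
  refine Finset.sum_congr rfl fun k _ => ?_
  rw [integral_const_mul, integral_axial_pow]
  simp only [mul_assoc (p.coeff k)]
  rw [intervalIntegral.integral_const_mul]
  simp only [sinMoment, zero_mul, exp_zero, one_mul]
  ring

/-- This reduction of axisymmetric integrals to one dimension needs no polar coordinates: the
moments agree by their common recursion, and Weierstrass approximation does the rest. -/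
lemma integral_axial_continuous {f : ℝ → ℝ} (hf : Continuous f) :
    ∫ m : Sph (d + 2), f (⟪b 0, (m : Euc d)⟫ ^ 2) ∂(surf (d + 2)) =
      (surf (d + 2)).real Set.univ / sinMoment d 0 0 *
        ∫ θ in (0 : ℝ)..π / 2, f (sin θ ^ 2) * cos θ ^ d := by
  have h0 := sinMoment_zero_pos d 0
  set S := (surf (d + 2)).real Set.univ
  have hS : 0 ≤ S := measureReal_nonneg
  refine eq_of_abs_sub_le_all fun ε hε => ?_
  -- Each side changes by at most εS/(2S + 1), so the two errors together stay below ε; the 1 keeps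
  -- the denominator positive.
  obtain ⟨p, hp⟩ := exists_polynomial_near_continuousMap 0 1
    (ContinuousMap.restrict _ ⟨f, hf⟩) (ε / (2 * S + 1)) (by positivity)
  have hp' : ∀ t ∈ Set.Icc (0 : ℝ) 1, |p.eval t - f t| ≤ ε / (2 * S + 1) := fun t ht =>
    ((ContinuousMap.norm_coe_le_norm _ (⟨t, ht⟩ : Set.Icc (0 : ℝ) 1)).trans hp.le :)
  have hmem : ∀ m : Sph (d + 2), ⟪b 0, (m : Euc d)⟫ ^ 2 ∈ Set.Icc (0 : ℝ) 1 := fun m => by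
    refine ⟨sq_nonneg _, ?_⟩
    have := abs_real_inner_le_norm (b 0) (m : Euc d)
    rw [b.norm_eq_one, norm_eq_of_mem_sphere, mul_one] at this
    rw [← sq_abs]
    exact pow_le_one₀ (abs_nonneg _) this
  have hpc := p.continuous
  have h1 : |∫ m : Sph (d + 2), p.eval (⟪b 0, (m : Euc d)⟫ ^ 2) ∂(surf (d + 2)) -
      ∫ m : Sph (d + 2), f (⟪b 0, (m : Euc d)⟫ ^ 2) ∂(surf (d + 2))| ≤ ε / (2 * S + 1) * S := by
    rw [← integral_sub (integrable_of_continuous (by fun_prop))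
      (integrable_of_continuous (by fun_prop))]
    exact norm_integral_le_of_norm_le_const (Filter.Eventually.of_forall fun m =>
      (norm_eq_abs _).trans_le (hp' _ (hmem m)))
  have h2 : |(∫ θ in (0 : ℝ)..π / 2, p.eval (sin θ ^ 2) * cos θ ^ d) -
      ∫ θ in (0 : ℝ)..π / 2, f (sin θ ^ 2) * cos θ ^ d| ≤ ε / (2 * S + 1) * sinMoment d 0 0 := by
    rw [← intervalIntegral.integral_sub (Continuous.intervalIntegrable (by fun_prop) _ _)
      (Continuous.intervalIntegrable (by fun_prop) _ _), sinMoment,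
      ← intervalIntegral.integral_const_mul, ← norm_eq_abs]
    refine intervalIntegral.norm_integral_le_of_norm_le
      (g := fun θ => ε / (2 * S + 1) * (exp (0 * sin θ ^ 2) * (sin θ ^ 2) ^ 0 * cos θ ^ d))
      (by positivity) (Filter.Eventually.of_forall fun θ hθ => ?_)
      (Continuous.intervalIntegrable (by fun_prop) _ _)
    have hc : 0 ≤ cos θ := cos_nonneg_of_mem_Icc ⟨by linarith [hθ.1, pi_pos], hθ.2⟩
    rw [← sub_mul, norm_mul, norm_of_nonneg (pow_nonneg hc d)]
    simp only [zero_mul, exp_zero, pow_zero, one_mul]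
    exact mul_le_mul_of_nonneg_right (hp' _ ⟨sq_nonneg _, sin_sq_le_one θ⟩) (pow_nonneg hc d)
  rw [integral_axial_polynomial] at h1
  have h3 := mul_le_mul_of_nonneg_left h2 (div_nonneg hS h0.le)
  rw [← abs_of_nonneg (div_nonneg hS h0.le), ← abs_mul, abs_of_nonneg (div_nonneg hS h0.le),
    mul_sub] at h3
  have h4 : S / sinMoment d 0 0 * (ε / (2 * S + 1) * sinMoment d 0 0) = ε / (2 * S + 1) * S := by
    field_simp
  rw [h4] at h3
  have h5 : ε / (2 * S + 1) * S + ε / (2 * S + 1) * S ≤ ε := by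
    rw [← mul_add, div_mul_eq_mul_div, div_le_iff₀ (by positivity)]
    nlinarith
  rw [abs_sub_comm] at h1
  exact (abs_sub_le _ _ _).trans ((add_le_add h1 h3).trans h5)

end Moments

/-! ### An abstract coercivity estimate. -/

/-- Coercivity of a quadratic form with finite rank interaction, given the Gram matrix of the
vectors `p`, `q i`, `r i j` that define the interaction. -/
lemma gram_coercive {H ι : Type*} [NormedAddCommGroup H] [InnerProductSpace ℝ H] [Fintype ι]
    [DecidableEq ι] [Nonempty ι] {F p : H} {q : ι → H} {r : ι → ι → H} {v w₁ w₂ c e α δ : ℝ}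
    (hpp : ⟪p, p⟫ = v) (hpq : ∀ i, ⟪p, q i⟫ = 0)
    (hqq : ∀ i j, ⟪q i, q j⟫ = if i = j then w₁ else 0) (hqr : ∀ i j k, ⟪q i, r j k⟫ = 0)
    (hpr : ∀ i j, ⟪p, r i j⟫ = if i = j then c else 0)
    (hrr : ∀ i j k l, ⟪r i j, r k l⟫ = (if i = k then if j = l then w₂ else 0 else 0) +
      (if i = l then if j = k then w₂ else 0 else 0) + if i = j then if k = l then e else 0 else 0)
    (htr : ∑ i, ⟪F, r i i⟫ = -⟪F, p⟫) (hsymm : ∀ i j, ⟪F, r i j⟫ = ⟪F, r j i⟫)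
    (hα : 0 < α) (hw₁ : 2 * α * w₁ = 1)
    (hv : α * ((Fintype.card ι + 1) / Fintype.card ι * v) ≤ 1 - δ) (hw₂ : α * (2 * w₂) ≤ 1 - δ) :
    δ * ‖F - (2 * α) • ∑ i, ⟪F, q i⟫ • q i‖ ^ 2 ≤
      ‖F‖ ^ 2 - α * (⟪F, p⟫ ^ 2 + 2 * ∑ i, ⟪F, q i⟫ ^ 2 + ∑ i, ∑ j, ⟪F, r i j⟫ ^ 2) := by
  set N : ℝ := (Fintype.card ι : ℝ) with hN
  have hN0 : 0 < N := by rw [hN]; exact_mod_cast Fintype.card_pos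
  set a := ⟪F, p⟫ with ha
  set κ := (N + 1) / N with hκ
  have hκ0 : 0 < κ := by positivity
  -- The traceless part of the matrix ⟨F, rᵢⱼ⟩: its trace is -⟨F, p⟩, so the trace part is absorbed
  -- in the p block, whose coefficient grows from 1 to κ = (N + 1)/N.
  set B : ι → ι → ℝ := fun i j => ⟪F, r i j⟫ + if i = j then a / N else 0 with hB
  have hBs : ∀ i j, B i j = B j i := fun i j => by simp only [hB, hsymm i j, eq_comm]
  have hBt : ∑ i, B i i = 0 := by
    simp only [hB, if_true, Finset.sum_add_distrib, htr, Finset.sum_const, Finset.card_univ,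
      nsmul_eq_mul, ← hN]
    field_simp
    ring
  have hM : ∀ i j, ⟪F, r i j⟫ = B i j - if i = j then a / N else 0 := fun i j => by simp [hB]
  have hM2 : ∑ i, ∑ j, ⟪F, r i j⟫ ^ 2 = ∑ i, ∑ j, B i j ^ 2 + a ^ 2 / N := by
    have e1 : ∀ i j, ⟪F, r i j⟫ ^ 2 = B i j ^ 2 + (if i = j then
        (-(2 * (a / N) * B i j) + (a / N) ^ 2) else 0) := fun i j => by
      rw [hM]; split_ifs <;> ring
    simp only [e1, Finset.sum_add_distrib, Finset.sum_ite_eq, Finset.mem_univ, if_true,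
      Finset.sum_neg_distrib, ← Finset.mul_sum, hBt, Finset.sum_const, Finset.card_univ,
      nsmul_eq_mul, ← hN]
    field_simp
    ring
  set b := ∑ i, ⟪F, q i⟫ ^ 2 with hb
  set D := ∑ i, ∑ j, B i j ^ 2 with hD
  have hD0 : 0 ≤ D := by positivity
  set y := ∑ i, ⟪F, q i⟫ • q i with hy
  set z := ∑ i, ∑ j, B i j • r i j with hz
  have hFy : ⟪F, y⟫ = b := by
    simp only [hy, inner_sum, real_inner_smul_right, hb, sq]
  have hyy : ⟪y, y⟫ = w₁ * b := by
    simp only [hy, inner_sum, sum_inner, real_inner_smul_right, real_inner_smul_left, hqq, hb,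
      mul_ite, mul_zero, Finset.sum_ite_eq', Finset.mem_univ, if_true, Finset.mul_sum]
    exact Finset.sum_congr rfl fun i _ => by ring
  have hFz : ⟪F, z⟫ = D := by
    have e1 : ∀ i j, B i j * ⟪F, r i j⟫ = B i j ^ 2 + if i = j then -(a / N) * B i j else 0 :=
      fun i j => by rw [hM]; split_ifs <;> ring
    simp only [hz, inner_sum, real_inner_smul_right, e1, Finset.sum_add_distrib,
      Finset.sum_ite_eq, Finset.mem_univ, if_true, ← Finset.mul_sum, hBt, mul_zero, add_zero, hD]
  have hyz : ⟪y, z⟫ = 0 := by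
    simp only [hy, hz, inner_sum, sum_inner, real_inner_smul_right, real_inner_smul_left, hqr,
      mul_zero, Finset.sum_const_zero]
  have hyp : ⟪y, p⟫ = 0 := by
    rw [real_inner_comm]
    simp only [hy, inner_sum, real_inner_smul_right, hpq, mul_zero, Finset.sum_const_zero]
  have hpz : ⟪p, z⟫ = 0 := by
    simp only [hz, inner_sum, real_inner_smul_right, hpr, mul_ite, mul_zero, Finset.sum_ite_eq,
      Finset.mem_univ, if_true, ← Finset.sum_mul, hBt, zero_mul]
  -- Tracelessness of B removes the e term here, and removed the c term in `hpz`.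
  have hrz : ∀ i j, ⟪r i j, z⟫ = 2 * w₂ * B i j := fun i j => by
    simp only [hz, inner_sum, real_inner_smul_right, hrr, mul_add, Finset.sum_add_distrib,
      mul_ite, mul_zero, Finset.sum_ite_irrel, Finset.sum_const_zero, Finset.sum_ite_eq,
      Finset.mem_univ, if_true, ← Finset.sum_mul, hBt, zero_mul, ite_self, hBs j i]
    ring
  have hzz : ⟪z, z⟫ = 2 * w₂ * D := by
    have hzx : ∀ x, ⟪z, x⟫ = ∑ i, ∑ j, B i j * ⟪r i j, x⟫ := fun x => by
      simp only [hz, sum_inner, real_inner_smul_left]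
    simp only [hzx z, hrz, hD, Finset.mul_sum]
    exact Finset.sum_congr rfl fun i _ => Finset.sum_congr rfl fun j _ => by ring
  -- As 2αw₁ = 1, the vector 2αy is the orthogonal projection of F on the span of the qᵢ, and the q
  -- terms of the form are exactly its squared norm.
  set F₁ := F - (2 * α) • y with hF₁
  -- S is chosen so that ⟨F₁, S⟩ is the remaining interaction A. Its blocks p and z are orthogonal,
  -- so the two hypotheses give α‖S‖² ≤ (1 - δ)A, and Cauchy-Schwarz gives αA ≤ (1 - δ)‖F₁‖².
  set S := (κ * a) • p + z with hS
  have hF₁n : ‖F₁‖ ^ 2 = ‖F‖ ^ 2 - 2 * α * b := by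
    rw [hF₁, norm_sub_sq_real, real_inner_smul_right, hFy, norm_smul, mul_pow,
      ← real_inner_self_eq_norm_sq y, hyy, norm_eq_abs, sq_abs]
    linear_combination (2 * α * b) * hw₁
  have hFS : ⟪F₁, S⟫ = κ * a ^ 2 + D := by
    simp only [hF₁, hS, inner_sub_left, inner_add_right, real_inner_smul_left,
      real_inner_smul_right, hyz, hyp, hFz, ← ha]
    ring
  have hSS : ⟪S, S⟫ = κ * a ^ 2 * (κ * v) + 2 * w₂ * D := by
    simp only [hS, inner_add_left, inner_add_right, real_inner_smul_left,
      real_inner_smul_right, hpz, real_inner_comm p z ▸ hpz, hzz, hpp]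
    ring
  set A := κ * a ^ 2 + D with hA
  have hA0 : 0 ≤ A := by positivity
  have hSA : α * ⟪S, S⟫ ≤ (1 - δ) * A := by
    rw [hSS, hA]
    have h1 := mul_le_mul_of_nonneg_right hv (by positivity : 0 ≤ κ * a ^ 2)
    have h2 := mul_le_mul_of_nonneg_right hw₂ hD0
    linarith
  have hCS : A * A ≤ ‖F₁‖ ^ 2 * ⟪S, S⟫ := by
    have := real_inner_mul_inner_self_le F₁ S
    rwa [hFS, real_inner_self_eq_norm_sq F₁] at this
  have hkey : α * A ≤ (1 - δ) * ‖F₁‖ ^ 2 := by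
    rcases hA0.eq_or_lt with h0 | h0
    · rw [← h0, mul_zero]
      rcases le_or_gt 0 (1 - δ) with h | h
      · positivity
      -- The bound `hv` has a nonnegative left side, which rules out δ > 1.
      · exfalso
        have h1 : 0 ≤ v := hpp ▸ real_inner_self_nonneg
        have : 0 ≤ α * (κ * v) := by positivity
        linarith
    · refine le_of_mul_le_mul_right ?_ h0
      calc α * A * A = α * (A * A) := by ring
        _ ≤ α * (‖F₁‖ ^ 2 * ⟪S, S⟫) := mul_le_mul_of_nonneg_left hCS hα.le
        _ = ‖F₁‖ ^ 2 * (α * ⟪S, S⟫) := by ring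
        _ ≤ ‖F₁‖ ^ 2 * ((1 - δ) * A) := mul_le_mul_of_nonneg_left hSA (sq_nonneg _)
        _ = (1 - δ) * ‖F₁‖ ^ 2 * A := by ring
  have : ‖F‖ ^ 2 - α * (a ^ 2 + 2 * b + ∑ i, ∑ j, ⟪F, r i j⟫ ^ 2) = ‖F₁‖ ^ 2 - α * A := by
    rw [hM2, hF₁n, hA, hκ]
    field_simp
    ring
  rw [this]
  linarith

/-! ### Moments of the density h_ν. -/

/-- The density `h_ν` as a function of `m · ν`. -/
def axialProfile (d : ℕ) (η x : ℝ) : ℝ :=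
  exp (η * x ^ 2) / ((surf (d + 2)).real Set.univ / sinMoment d 0 0 * sinMoment d 0 η)

lemma contDiff_axialProfile (d : ℕ) (η : ℝ) : ContDiff ℝ 1 (axialProfile d η) := by
  unfold axialProfile
  fun_prop

lemma surf_univ_pos (d : ℕ) : 0 < (surf (d + 2)).real Set.univ := by
  refine ENNReal.toReal_pos ?_ (measure_ne_top _ _)
  rw [Measure.measure_univ_ne_zero]
  exact Measure.toSphere_ne_zero _

lemma axialProfile_pos (d : ℕ) (η x : ℝ) : 0 < axialProfile d η x := by
  have := surf_univ_pos d
  have := sinMoment_zero_pos d 0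
  have := sinMoment_zero_pos d η
  unfold axialProfile
  positivity

lemma axialProfile_le (d : ℕ) {η x : ℝ} (hη : 0 ≤ η) (hx : |x| ≤ 1) :
    axialProfile d η x ≤ axialProfile d η 1 := by
  have := surf_univ_pos d
  have := sinMoment_zero_pos d 0
  have := sinMoment_zero_pos d η
  unfold axialProfile
  have h : x ^ 2 ≤ 1 ^ 2 := by rwa [sq_le_sq, abs_one]
  gcongr

section Weighted

variable {d : ℕ} (b : OrthonormalBasis (Fin (d + 2)) ℝ (Euc d)) (η : ℝ)

lemma axial_eq_axialProfile {ν : Sph (d + 2)} (hb : b 0 = (ν : Euc d)) (m : Sph (d + 2)) :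
    axial η ν m = axialProfile d η ⟪b 0, (m : Euc d)⟫ := by
  unfold axial axialProfile
  simp only [← hb, real_inner_comm (b 0)]
  rw [integral_axial_continuous b (f := fun t => exp (η * t)) (by fun_prop)]
  simp [sinMoment]

lemma integral_axialProfile_mul {f : ℝ → ℝ} (hf : Continuous f) :
    ∫ m : Sph (d + 2), axialProfile d η ⟪b 0, (m : Euc d)⟫ * f (⟪b 0, (m : Euc d)⟫ ^ 2)
      ∂(surf (d + 2)) =
      (∫ θ in (0 : ℝ)..π / 2, exp (η * sin θ ^ 2) * f (sin θ ^ 2) * cos θ ^ d) /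
        sinMoment d 0 η := by
  have h1 := surf_univ_pos d
  have h2 := sinMoment_zero_pos d 0
  have h3 := sinMoment_zero_pos d η
  simp only [axialProfile, div_mul_eq_mul_div]
  rw [integral_div, integral_axial_continuous b (f := fun t => exp (η * t) * f t) (by fun_prop)]
  field_simp

lemma integral_axialProfile_pow (k : ℕ) :
    ∫ m : Sph (d + 2), axialProfile d η ⟪b 0, (m : Euc d)⟫ * (⟪b 0, (m : Euc d)⟫ ^ 2) ^ k
      ∂(surf (d + 2)) = sinMoment d k η / sinMoment d 0 η :=
  integral_axialProfile_mul b η (f := fun t => t ^ k) (by fun_prop)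

lemma integral_axialProfile :
    ∫ m : Sph (d + 2), axialProfile d η ⟪b 0, (m : Euc d)⟫ ∂(surf (d + 2)) = 1 := by
  have h := integral_axialProfile_pow b η 0
  rw [div_self (sinMoment_zero_pos d η).ne'] at h
  simpa using h

lemma integral_axialProfile_sq :
    ∫ m : Sph (d + 2), axialProfile d η ⟪b 0, (m : Euc d)⟫ * ⟪b 0, (m : Euc d)⟫ ^ 2
      ∂(surf (d + 2)) = sinMean d η := by
  simpa [sinMean] using integral_axialProfile_pow b η 1

lemma integral_axialProfile_fourth :
    ∫ m : Sph (d + 2), axialProfile d η ⟪b 0, (m : Euc d)⟫ * ⟪b 0, (m : Euc d)⟫ ^ 4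
      ∂(surf (d + 2)) = sinMean d η - sinCosMean d η := by
  have h := integral_axialProfile_pow b η 2
  simp only [← pow_mul] at h
  rw [h, sinMean, sinCosMean]
  ring

/-- The integral of a quadratic polynomial in `(m · ν)²` against the density. -/
lemma integral_axialProfile_quadratic (c₀ c₁ c₂ : ℝ) {f : Sph (d + 2) → ℝ}
    (hf : ∀ m : Sph (d + 2), f m = axialProfile d η ⟪b 0, (m : Euc d)⟫ *
      (c₀ + c₁ * ⟪b 0, (m : Euc d)⟫ ^ 2 + c₂ * ⟪b 0, (m : Euc d)⟫ ^ 4)) :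
    ∫ m : Sph (d + 2), f m ∂(surf (d + 2)) =
      c₀ + c₁ * sinMean d η + c₂ * (sinMean d η - sinCosMean d η) := by
  have hc := (contDiff_axialProfile d η).continuous
  have h0 : c₀ = c₀ * ∫ m : Sph (d + 2), axialProfile d η ⟪b 0, (m : Euc d)⟫ ∂(surf (d + 2)) := by
    rw [integral_axialProfile b η, mul_one]
  rw [h0, ← integral_axialProfile_fourth b η,
    ← integral_axialProfile_sq b η, ← integral_const_mul, ← integral_const_mul,
    ← integral_const_mul, ← integral_add (integrable_of_continuous (by fun_prop))
    (integrable_of_continuous (by fun_prop)), ← integral_add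
    (integrable_of_continuous (by fun_prop)) (integrable_of_continuous (by fun_prop))]
  refine integral_congr_ae (Filter.Eventually.of_forall fun m => ?_)
  simp only [hf]
  ring

lemma integral_axialProfile_perp (i j : Fin (d + 1)) :
    ∫ m : Sph (d + 2), axialProfile d η ⟪b 0, (m : Euc d)⟫ *
      (⟪b i.succ, (m : Euc d)⟫ * ⟪b j.succ, (m : Euc d)⟫) ∂(surf (d + 2)) =
      if i = j then (1 - sinMean d η) / (d + 1) else 0 := by
  have h := integral_perp_second_moment b (contDiff_axialProfile d η) i j
  rw [integral_axialProfile_quadratic b η 1 (-1) 0 (f := fun m =>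
    axialProfile d η ⟪b 0, (m : Euc d)⟫ * (1 - ⟪b 0, (m : Euc d)⟫ ^ 2))
    (fun m => by ring)] at h
  have hd : (d : ℝ) + 1 ≠ 0 := by positivity
  rw [← mul_right_inj' hd, h]
  split_ifs
  · field_simp; ring
  · ring

lemma integral_axialProfile_sq_perp (i j : Fin (d + 1)) :
    ∫ m : Sph (d + 2), axialProfile d η ⟪b 0, (m : Euc d)⟫ * ⟪b 0, (m : Euc d)⟫ ^ 2 *
      (⟪b i.succ, (m : Euc d)⟫ * ⟪b j.succ, (m : Euc d)⟫) ∂(surf (d + 2)) =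
      if i = j then sinCosMean d η / (d + 1) else 0 := by
  have h := integral_perp_second_moment b (G := fun x => axialProfile d η x * x ^ 2)
    ((contDiff_axialProfile d η).mul (by fun_prop)) i j
  rw [integral_axialProfile_quadratic b η 0 1 (-1) (f := fun m =>
    axialProfile d η ⟪b 0, (m : Euc d)⟫ * ⟪b 0, (m : Euc d)⟫ ^ 2 * (1 - ⟪b 0, (m : Euc d)⟫ ^ 2))
    (fun m => by ring)] at h
  have hd : (d : ℝ) + 1 ≠ 0 := by positivity
  rw [← mul_right_inj' hd, h]
  split_ifs
  · field_simp; ring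
  · ring

lemma integral_axialProfile_perp_fourth (i j k l : Fin (d + 1)) :
    ∫ m : Sph (d + 2), axialProfile d η ⟪b 0, (m : Euc d)⟫ *
        (⟪b i.succ, (m : Euc d)⟫ * (⟪b j.succ, (m : Euc d)⟫ *
          ⟪b k.succ, (m : Euc d)⟫ * ⟪b l.succ, (m : Euc d)⟫)) ∂(surf (d + 2)) =
      ((if i = j then 1 else 0) * (if k = l then 1 else 0) +
        (if i = k then 1 else 0) * (if j = l then 1 else 0) +
        (if i = l then 1 else 0) * (if j = k then 1 else 0)) *
      ((1 - sinMean d η - sinCosMean d η) / ((d + 1) * (d + 3))) := by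
  have h := integral_perp_fourth_moment b (contDiff_axialProfile d η) i j k l
  rw [integral_axialProfile_quadratic b η 1 (-2) 1 (f := fun m =>
    axialProfile d η ⟪b 0, (m : Euc d)⟫ * (1 - ⟪b 0, (m : Euc d)⟫ ^ 2) ^ 2) (fun m => by ring)] at h
  have hd : ((d : ℝ) + 1) * (d + 3) ≠ 0 := by positivity
  rw [← mul_right_inj' hd, h]
  generalize ((if i = j then 1 else 0) * (if k = l then 1 else 0) +
        (if i = k then 1 else 0) * (if j = l then 1 else 0) +
        (if i = l then 1 else 0) * (if j = k then 1 else 0) : ℝ) = A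
  field_simp
  ring

lemma integral_axialProfile_odd {f : ℝ → (Fin (d + 1) → ℝ) → ℝ}
    (hf : Continuous fun m : Sph (d + 2) => f ⟪b 0, (m : Euc d)⟫ fun i => ⟪b i.succ, (m : Euc d)⟫)
    (h : ∀ x y, f x (fun i => -y i) = -f x y) :
    ∫ m : Sph (d + 2), axialProfile d η ⟪b 0, (m : Euc d)⟫ *
      f ⟪b 0, (m : Euc d)⟫ (fun i => ⟪b i.succ, (m : Euc d)⟫) ∂(surf (d + 2)) = 0 := by
  have hc := (contDiff_axialProfile d η).continuous
  refine integral_eq_zero_of_perp_odd b (f := fun x y => axialProfile d η x * f x y)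
    (Continuous.mul (by fun_prop) hf) fun x y => ?_
  rw [h]; ring

end Weighted

/-- With t = sin² θ the claim is ⟨(1 - t)²⟩ < (d + 3)⟨t(1 - t)⟩. It is `sinMoment_by_parts` with the
weight cosᵈ⁺² θ, where the η term is strictly positive. -/
lemma perp_fourth_lt (d : ℕ) {η : ℝ} (hη : 0 < η) :
    1 - sinMean d η - sinCosMean d η < (d + 3) * sinCosMean d η := by
  have h := sinMoment_by_parts (d + 2) 0 η
  have h2 := sinMoment_two_lt (d + 2) η
  have h0 := sinMoment_zero_pos d η
  have e : ∀ k, sinMoment (d + 2) k η = sinMoment d k η - sinMoment d (k + 1) η :=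
    fun k => sinMoment_sub d k η
  have h3 : 0 < η * (sinMoment (d + 2) 1 η - sinMoment (d + 2) 2 η) :=
    mul_pos hη (sub_pos.2 h2)
  have h4 : (sinMoment (d + 2) 0 η - sinMoment (d + 2) 1 η) <
      (d + 3) * sinMoment (d + 2) 1 η := by
    push_cast at h
    norm_num at h
    linarith
  rw [e 0, e 1] at h4
  norm_num at h4
  unfold sinMean sinCosMean
  rw [← sub_pos] at h4 ⊢
  have : (d + 3) * ((sinMoment d 1 η - sinMoment d 2 η) / sinMoment d 0 η) -
      (1 - sinMoment d 1 η / sinMoment d 0 η -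
        (sinMoment d 1 η - sinMoment d 2 η) / sinMoment d 0 η) =
      ((d + 3) * (sinMoment d 1 η - sinMoment d 2 η) - (sinMoment d 0 η - sinMoment d 1 η -
        (sinMoment d 1 η - sinMoment d 2 η))) / sinMoment d 0 η := by
    field_simp
  rw [this]
  positivity

lemma exists_basis_first {d : ℕ} (ν : Sph (d + 2)) :
    ∃ b : OrthonormalBasis (Fin (d + 2)) ℝ (Euc d), b 0 = (ν : Euc d) := by
  have hv : Orthonormal ℝ (({0} : Set (Fin (d + 2))).domRestrict fun _ => (ν : Euc d)) := by
    refine ⟨fun i => norm_eq_of_mem_sphere ν, fun i j hij => ?_⟩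
    exact absurd (Subsingleton.elim i j) hij
  obtain ⟨b, hb⟩ := hv.exists_orthonormalBasis_extension_of_card_eq (by simp)
  exact ⟨b, hb 0 rfl⟩

lemma coeFn_secondVariation {n : ℕ} (α : ℝ) (f₀ : Sph n → ℝ) (hc : Continuous f₀)
    (hpos : ∀ m, 0 < f₀ m) (φ : V n) :
    ((secondVariation α f₀ hc hpos φ : V n) : L2 n) =ᵐ[surf n]
      secondVariationFun α f₀ (φ : L2 n) :=
  MemLp.coeFn_toLp (memLp_secondVariationFun α hc hpos (Lp.memLp (φ : L2 n)))

lemma L2_inner_eq {n : ℕ} (f g : L2 n) : inner ℝ f g = ∫ m, f m * g m ∂(surf n) := by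
  rw [L2.inner_def]
  refine integral_congr_ae (Filter.Eventually.of_forall fun m => ?_)
  simp [mul_comm]

lemma integrable_L2_mul {n : ℕ} (f g : L2 n) : Integrable (fun m => f m * g m) (surf n) :=
  (Lp.memLp f).integrable_mul (Lp.memLp g)

lemma integrable_mul_continuous {n : ℕ} {f φ : Sph n → ℝ} (hf : Continuous f)
    (hφ : Integrable φ (surf n)) : Integrable (fun m => f m * φ m) (surf n) := by
  obtain ⟨C, hC⟩ := (isCompact_univ.image hf).isBounded.exists_norm_le
  exact hφ.bdd_mul hf.aestronglyMeasurable (c := C)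
    (Filter.Eventually.of_forall fun m => hC _ ⟨m, trivial, rfl⟩)

/-! ### The interaction kernel, the critical point and the neutral directions. -/

section Kernel

variable {d : ℕ} (b : OrthonormalBasis (Fin (d + 2)) ℝ (Euc d))

lemma inner_sq_eq_sum (m m' : Sph (d + 2)) :
    ⟪(m : Euc d), (m' : Euc d)⟫ ^ 2 =
      ⟪b 0, (m : Euc d)⟫ ^ 2 * ⟪b 0, (m' : Euc d)⟫ ^ 2 +
      2 * ∑ i : Fin (d + 1), (⟪b 0, (m : Euc d)⟫ * ⟪b i.succ, (m : Euc d)⟫) *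
        (⟪b 0, (m' : Euc d)⟫ * ⟪b i.succ, (m' : Euc d)⟫) +
      ∑ i : Fin (d + 1), ∑ j : Fin (d + 1),
        (⟪b i.succ, (m : Euc d)⟫ * ⟪b j.succ, (m : Euc d)⟫) *
        (⟪b i.succ, (m' : Euc d)⟫ * ⟪b j.succ, (m' : Euc d)⟫) := by
  rw [← b.sum_inner_mul_inner (m : Euc d) m', Fin.sum_univ_succ, add_sq, sq (Finset.sum _ _),
    Finset.sum_mul_sum, Finset.mul_sum, Finset.mul_sum]
  simp only [real_inner_comm (b _) (m : Euc d)]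
  congr 1
  · congr 1
    · ring
    · exact Finset.sum_congr rfl fun i _ => by ring
  · exact Finset.sum_congr rfl fun i _ => Finset.sum_congr rfl fun j _ => by ring

lemma integral_kernel_mul {φ : Sph (d + 2) → ℝ} (hφ : Integrable φ (surf (d + 2)))
    (m : Sph (d + 2)) :
    ∫ m' : Sph (d + 2), ⟪(m : Euc d), (m' : Euc d)⟫ ^ 2 * φ m' ∂(surf (d + 2)) =
      ⟪b 0, (m : Euc d)⟫ ^ 2 * ∫ m' : Sph (d + 2), ⟪b 0, (m' : Euc d)⟫ ^ 2 * φ m' ∂(surf (d + 2)) +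
      2 * ∑ i : Fin (d + 1), (⟪b 0, (m : Euc d)⟫ * ⟪b i.succ, (m : Euc d)⟫) *
        ∫ m' : Sph (d + 2), ⟪b 0, (m' : Euc d)⟫ * ⟪b i.succ, (m' : Euc d)⟫ * φ m'
          ∂(surf (d + 2)) +
      ∑ i : Fin (d + 1), ∑ j : Fin (d + 1),
        (⟪b i.succ, (m : Euc d)⟫ * ⟪b j.succ, (m : Euc d)⟫) *
        ∫ m' : Sph (d + 2), ⟪b i.succ, (m' : Euc d)⟫ * ⟪b j.succ, (m' : Euc d)⟫ * φ m'
          ∂(surf (d + 2)) := by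
  have i0 : Integrable (fun m' : Sph (d + 2) => ⟪b 0, (m : Euc d)⟫ ^ 2 *
      (⟪b 0, (m' : Euc d)⟫ ^ 2 * φ m')) (surf (d + 2)) :=
    (integrable_mul_continuous (by fun_prop) hφ).const_mul _
  have i1 : ∀ i : Fin (d + 1), Integrable (fun m' : Sph (d + 2) => ⟪b 0, (m : Euc d)⟫ *
      ⟪b i.succ, (m : Euc d)⟫ * (⟪b 0, (m' : Euc d)⟫ * ⟪b i.succ, (m' : Euc d)⟫ * φ m'))
      (surf (d + 2)) := fun i =>
    (integrable_mul_continuous (by fun_prop) hφ).const_mul _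
  have i2 : ∀ i j : Fin (d + 1), Integrable (fun m' : Sph (d + 2) => ⟪b i.succ, (m : Euc d)⟫ *
      ⟪b j.succ, (m : Euc d)⟫ * (⟪b i.succ, (m' : Euc d)⟫ * ⟪b j.succ, (m' : Euc d)⟫ * φ m'))
      (surf (d + 2)) := fun i j =>
    (integrable_mul_continuous (by fun_prop) hφ).const_mul _
  have i3 : Integrable (fun m' : Sph (d + 2) => ⟪b 0, (m : Euc d)⟫ ^ 2 *
      (⟪b 0, (m' : Euc d)⟫ ^ 2 * φ m') + 2 * ∑ i : Fin (d + 1), ⟪b 0, (m : Euc d)⟫ *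
      ⟪b i.succ, (m : Euc d)⟫ * (⟪b 0, (m' : Euc d)⟫ * ⟪b i.succ, (m' : Euc d)⟫ * φ m'))
      (surf (d + 2)) := i0.add ((integrable_finsetSum _ fun i _ => i1 i).const_mul _)
  simp only [← integral_const_mul]
  have e2 : ∀ i : Fin (d + 1), ∑ j : Fin (d + 1), ∫ m' : Sph (d + 2), ⟪b i.succ, (m : Euc d)⟫ *
      ⟪b j.succ, (m : Euc d)⟫ * (⟪b i.succ, (m' : Euc d)⟫ * ⟪b j.succ, (m' : Euc d)⟫ * φ m')
      ∂(surf (d + 2)) = _ := fun i => (integral_finsetSum _ fun j _ => i2 i j).symm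
  simp only [e2]
  rw [← integral_finsetSum _ fun i _ => i1 i, ← integral_finsetSum _ fun i _ =>
    integrable_finsetSum _ fun j _ => i2 i j, ← integral_const_mul,
    ← integral_add i0 ((integrable_finsetSum _ fun i _ => i1 i).const_mul _), ← integral_add i3
    (integrable_finsetSum _ fun i _ => integrable_finsetSum _ fun j _ => i2 i j)]
  refine integral_congr_ae (Filter.Eventually.of_forall fun m' => ?_)
  simp only [inner_sq_eq_sum b m m', add_mul, Finset.sum_mul, mul_assoc]

end Kernel

lemma axial_isCriticalPoint (d : ℕ) (η : ℝ) (ν : Sph (d + 2)) :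
    IsCriticalPoint (sigma (d + 2) 1 η) (axial η ν) := by
  obtain ⟨b, hb⟩ := exists_basis_first ν
  have hax := axial_eq_axialProfile b η hb
  refine ⟨axial_pos η ν, ?_, ?_⟩
  · simp only [hax]
    exact integral_axialProfile b η
  have hcont := (contDiff_axialProfile d η).continuous
  set α := sigma (d + 2) 1 η with hα
  set a := sinMean d η with ha
  have hw := sinCosMean_pos d η
  have hd : (0 : ℝ) < d + 1 := by positivity
  -- Matching of the x² coefficients in the Euler-Lagrange equation: the interaction contributes αa
  -- from the axis and α(1 - a)/(d + 1) from the perpendicular directions, where Σ yᵢ² = 1 - x².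
  have hη : η = α * (a - (1 - a) / (d + 1)) := by
    have h := sinCosMean_eq d η
    rw [hα, sigma_one_eq]
    field_simp
    linarith
  refine ⟨-log ((surf (d + 2)).real Set.univ / sinMoment d 0 0 * sinMoment d 0 η) -
    α * ((1 - a) / (d + 1)), fun m => ?_⟩
  have hint : Integrable (fun m : Sph (d + 2) => axialProfile d η ⟪b 0, (m : Euc d)⟫)
    (surf (d + 2)) := integrable_of_continuous (by fun_prop)
  simp only [hax]
  have e1 := integral_axialProfile_sq b η
  have e2 : ∀ i : Fin (d + 1), ∫ m : Sph (d + 2), axialProfile d η ⟪b 0, (m : Euc d)⟫ *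
      (⟪b 0, (m : Euc d)⟫ * ⟪b i.succ, (m : Euc d)⟫) ∂(surf (d + 2)) = 0 := fun i =>
    integral_axialProfile_odd b η (f := fun x y => x * y i) (by fun_prop) fun x y => by ring
  have e3 := integral_axialProfile_perp b η
  rw [integral_kernel_mul b hint]
  simp only [mul_comm _ (axialProfile d η _), e1, e2, e3]
  simp only [mul_zero, mul_ite, Finset.sum_const_zero, Finset.sum_ite_eq, Finset.mem_univ,
    if_true, ← sq, ← Finset.sum_mul, sum_inner_succ_sq, ← ha]
  have hne : (surf (d + 2)).real Set.univ / sinMoment d 0 0 * sinMoment d 0 η ≠ 0 := by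
    have := surf_univ_pos d
    have := sinMoment_zero_pos d 0
    have := sinMoment_zero_pos d η
    positivity
  rw [axialProfile, log_div (exp_pos _).ne' hne, log_exp]
  linear_combination ⟪b 0, (m : Euc d)⟫ ^ 2 * hη

section Tangent

variable {d : ℕ} {b : OrthonormalBasis (Fin (d + 2)) ℝ (Euc d)} {ν : Sph (d + 2)}

lemma inner_sub_axis (hb : b 0 = (ν : Euc d)) (u m : Euc d) :
    ⟪u, m - ⟪m, (ν : Euc d)⟫ • (ν : Euc d)⟫ =
      ∑ i : Fin (d + 1), ⟪u, b i.succ⟫ * ⟪b i.succ, m⟫ := by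
  have h := b.sum_inner_mul_inner u m
  rw [Fin.sum_univ_succ] at h
  rw [inner_sub_right, real_inner_smul_right, ← h, ← hb, real_inner_comm (b 0) m]
  ring

/-- The component of u along ν does not matter; the coefficients cᵢ are the other coordinates of u.
-/
lemma mem_Vtop_iff (hb : b 0 = (ν : Euc d)) (η : ℝ) (φ : L2 (d + 2)) :
    φ ∈ Vtop η ν ↔ ∃ c : Fin (d + 1) → ℝ, φ =ᵐ[surf (d + 2)] fun m : Sph (d + 2) =>
      (∑ i, c i * (⟪b 0, (m : Euc d)⟫ * ⟪b i.succ, (m : Euc d)⟫)) *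
        axialProfile d η ⟪b 0, (m : Euc d)⟫ := by
  have key : ∀ (u : Euc d) (m : Sph (d + 2)), ⟪u, (m : Euc d) - ⟪(m : Euc d), (ν : Euc d)⟫ •
      (ν : Euc d)⟫ * ⟪(m : Euc d), (ν : Euc d)⟫ * axial η ν m =
      (∑ i : Fin (d + 1), ⟪u, b i.succ⟫ * (⟪b 0, (m : Euc d)⟫ * ⟪b i.succ, (m : Euc d)⟫)) *
        axialProfile d η ⟪b 0, (m : Euc d)⟫ := fun u m => by
    rw [inner_sub_axis hb, axial_eq_axialProfile b η hb, ← hb, real_inner_comm, Finset.sum_mul]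
    congr 1
    exact Finset.sum_congr rfl fun i _ => by ring
  constructor
  · rintro ⟨u, hu⟩
    refine ⟨fun i => ⟪u, b i.succ⟫, hu.trans (Filter.Eventually.of_forall fun m => key u m)⟩
  · rintro ⟨c, hc⟩
    refine ⟨∑ i, c i • b i.succ, hc.trans (Filter.Eventually.of_forall fun m => ?_)⟩
    have hci : ∀ i : Fin (d + 1), ⟪∑ j, c j • b j.succ, b i.succ⟫ = c i := fun i => by
      simp [sum_inner, real_inner_smul_left, orthonormal_iff_ite.1 b.orthonormal]
    simp only
    rw [key]
    simp only [hci]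

end Tangent

/-- The functions in `Vtop` are in the kernel of the second variation. -/
lemma Vtop_le_ker (d : ℕ) (η : ℝ) (ν : Sph (d + 2)) :
    Vtop η ν ≤ (LinearMap.ker (axialSecondVariation η ν)).map (V (d + 2)).subtype := by
  obtain ⟨b, hb⟩ := exists_basis_first ν
  have hax := axial_eq_axialProfile b η hb
  have hcont := (contDiff_axialProfile d η).continuous
  intro φ hφ
  obtain ⟨c, hc⟩ := (mem_Vtop_iff hb η φ).1 hφ
  set f : ℝ → (Fin (d + 1) → ℝ) → ℝ := fun x y => ∑ i, c i * (x * y i) with hf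
  have hint : ∀ g : Sph (d + 2) → ℝ, ∫ m, g m * φ m ∂(surf (d + 2)) =
      ∫ m : Sph (d + 2), axialProfile d η ⟪b 0, (m : Euc d)⟫ * (g m *
        f ⟪b 0, (m : Euc d)⟫ fun i => ⟪b i.succ, (m : Euc d)⟫) ∂(surf (d + 2)) := fun g => by
    refine integral_congr_ae ?_
    filter_upwards [hc] with m hm
    rw [hm]
    ring
  have hmean : ∫ m, φ m ∂(surf (d + 2)) = 0 := by
    have e := hint fun _ => 1
    simp only [one_mul] at e
    rw [e]
    refine integral_axialProfile_odd b η (f := f) (by fun_prop) fun x y => ?_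
    simp only [hf, mul_neg, Finset.sum_neg_distrib]
  have hX : ∫ m : Sph (d + 2), ⟪b 0, (m : Euc d)⟫ ^ 2 * φ m ∂(surf (d + 2)) = 0 := by
    rw [hint]
    refine integral_axialProfile_odd b η (f := fun x y => x ^ 2 * f x y) (by fun_prop)
      fun x y => ?_
    simp only [hf, mul_neg, Finset.sum_neg_distrib]
  have hR : ∀ i j : Fin (d + 1), ∫ m : Sph (d + 2), ⟪b i.succ, (m : Euc d)⟫ *
      ⟪b j.succ, (m : Euc d)⟫ * φ m ∂(surf (d + 2)) = 0 := fun i j => by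
    rw [hint]
    refine integral_axialProfile_odd b η (f := fun x y => y i * y j * f x y) (by fun_prop)
      fun x y => ?_
    simp only [hf, mul_neg, Finset.sum_neg_distrib]
    ring
  have hQ : ∀ i : Fin (d + 1), ∫ m : Sph (d + 2), ⟪b 0, (m : Euc d)⟫ *
      ⟪b i.succ, (m : Euc d)⟫ * φ m ∂(surf (d + 2)) = sinCosMean d η / (d + 1) * c i :=
      fun i => by
    have e : ∀ j : Fin (d + 1), c j * ∫ m : Sph (d + 2), axialProfile d η ⟪b 0, (m : Euc d)⟫ *
        ⟪b 0, (m : Euc d)⟫ ^ 2 * (⟪b i.succ, (m : Euc d)⟫ * ⟪b j.succ, (m : Euc d)⟫)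
          ∂(surf (d + 2)) = if i = j then sinCosMean d η / (d + 1) * c j else 0 := fun j => by
      rw [integral_axialProfile_sq_perp]
      split_ifs <;> ring
    have e2 := Finset.sum_congr rfl fun j (_ : j ∈ Finset.univ) => e j
    simp only [Finset.sum_ite_eq, Finset.mem_univ, if_true, ← integral_const_mul] at e2
    rw [← integral_finsetSum _ fun j _ => integrable_of_continuous (by fun_prop)] at e2
    rw [hint, ← e2]
    refine integral_congr_ae (Filter.Eventually.of_forall fun m => ?_)
    simp only [hf, Finset.mul_sum]
    exact Finset.sum_congr rfl fun j _ => by ring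
  refine ⟨⟨φ, hmean⟩, ?_, rfl⟩
  rw [SetLike.mem_coe, LinearMap.mem_ker]
  apply Subtype.ext
  apply Lp.ext
  refine (coeFn_secondVariation _ _ _ _ _).trans ?_
  -- Only the x yᵢ block sees φ, with factor 2α · w/(d + 1) = 1, so the interaction cancels φ/h_ν
  -- pointwise.
  have hpre : preSecondVariation (sigma (d + 2) 1 η) (axial η ν) φ =ᵐ[surf (d + 2)] 0 := by
    filter_upwards [hc] with m hm
    have hpos := axialProfile_pos d η ⟪b 0, (m : Euc d)⟫
    have hw := sinCosMean_pos d η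
    have hd : (0 : ℝ) < d + 1 := by positivity
    simp only [preSecondVariation]
    rw [integral_kernel_mul b ((Lp.memLp φ).integrable (by norm_num)), hX, hm, hax]
    simp only [hR, hQ, mul_zero, Finset.sum_const_zero, sigma_one_eq, Pi.zero_apply]
    have e : ∑ i : Fin (d + 1), ⟪b 0, (m : Euc d)⟫ * ⟪b i.succ, (m : Euc d)⟫ *
        (sinCosMean d η / (d + 1) * c i) = sinCosMean d η / (d + 1) *
        ∑ i, c i * (⟪b 0, (m : Euc d)⟫ * ⟪b i.succ, (m : Euc d)⟫) := by
      rw [Finset.mul_sum]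
      exact Finset.sum_congr rfl fun i _ => by ring
    rw [e, mul_div_cancel_right₀ _ hpos.ne']
    generalize ∑ i, c i * (⟪b 0, (m : Euc d)⟫ * ⟪b i.succ, (m : Euc d)⟫) = A
    field_simp
    ring
  have havg : ⨍ m, preSecondVariation (sigma (d + 2) 1 η) (axial η ν) φ m ∂(surf (d + 2)) = 0 := by
    rw [average_congr hpre]
    simp [average_eq]
  filter_upwards [hpre, Lp.coeFn_zero ℝ 2 (surf (d + 2))] with m hm h0
  rw [secondVariationFun, hm, havg]
  simpa using h0.symm

/-! ### Coercivity of the second variation. -/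

/-- The coordinate `m · b i`, as a continuous function on the sphere. -/
def coord {d : ℕ} (b : OrthonormalBasis (Fin (d + 2)) ℝ (Euc d)) (i : Fin (d + 2)) :
    C(Sph (d + 2), ℝ) :=
  ⟨fun m => ⟪b i, (m : Euc d)⟫, by fun_prop⟩

/-- The square root of the density `h_ν`, where `ν = b 0`. -/
def sqrtProfile {d : ℕ} (b : OrthonormalBasis (Fin (d + 2)) ℝ (Euc d)) (η : ℝ) :
    C(Sph (d + 2), ℝ) :=
  ⟨fun m => √(axialProfile d η ⟪b 0, (m : Euc d)⟫), by
    have := (contDiff_axialProfile d η).continuous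
    fun_prop⟩

/-- The embedding of continuous functions into `L²` for the measure with density `h_ν`. -/
def weightedLift {d : ℕ} (b : OrthonormalBasis (Fin (d + 2)) ℝ (Euc d)) (η : ℝ)
    (f : C(Sph (d + 2), ℝ)) : L2 (d + 2) :=
  ContinuousMap.toLp 2 (surf (d + 2)) ℝ (f * sqrtProfile b η)

section Coercive

variable {d : ℕ} (b : OrthonormalBasis (Fin (d + 2)) ℝ (Euc d)) (η : ℝ)

lemma coeFn_weightedLift (f : C(Sph (d + 2), ℝ)) :
    weightedLift b η f =ᵐ[surf (d + 2)] fun m => f m * √(axialProfile d η ⟪b 0, (m : Euc d)⟫) :=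
  ContinuousMap.coeFn_toLp (𝕜 := ℝ) _ _

lemma inner_weightedLift (f g : C(Sph (d + 2), ℝ)) :
    ⟪weightedLift b η f, weightedLift b η g⟫ =
      ∫ m : Sph (d + 2), axialProfile d η ⟪b 0, (m : Euc d)⟫ * (f m * g m) ∂(surf (d + 2)) := by
  rw [L2_inner_eq]
  refine integral_congr_ae ?_
  filter_upwards [coeFn_weightedLift b η f, coeFn_weightedLift b η g] with m hf hg
  rw [hf, hg]
  linear_combination (f m * g m) * mul_self_sqrt (axialProfile_pos d η ⟪b 0, (m : Euc d)⟫).le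

/-- Division by `√h_ν` as a map on `L²`. -/
lemma exists_div_sqrtProfile (ψ : L2 (d + 2)) : ∃ Φ : L2 (d + 2),
    Φ =ᵐ[surf (d + 2)] fun m => ψ m / √(axialProfile d η ⟪b 0, (m : Euc d)⟫) := by
  have hcont := (contDiff_axialProfile d η).continuous
  have hinv : Continuous fun m : Sph (d + 2) => (√(axialProfile d η ⟪b 0, (m : Euc d)⟫))⁻¹ :=
    Continuous.inv₀ (by fun_prop) fun m => (sqrt_pos.2 (axialProfile_pos d η _)).ne'
  obtain ⟨C, hC⟩ := (isCompact_univ.image hinv).isBounded.exists_norm_le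
  have hb : MemLp (fun m : Sph (d + 2) => (√(axialProfile d η ⟪b 0, (m : Euc d)⟫))⁻¹) ∞
      (surf (d + 2)) :=
    memLp_top_of_bound hinv.aestronglyMeasurable C
      (Filter.Eventually.of_forall fun m => hC _ ⟨m, trivial, rfl⟩)
  have h : MemLp (fun m : Sph (d + 2) => ψ m / √(axialProfile d η ⟪b 0, (m : Euc d)⟫)) 2
      (surf (d + 2)) :=
    ((Lp.memLp ψ).mul (r := 2) hb).ae_eq (Filter.Eventually.of_forall fun m => by
      simp [div_eq_mul_inv, mul_comm])
  exact ⟨h.toLp _, h.coeFn_toLp⟩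

/-- The factors √h_ν cancel: pairings with Φ = ψ/√h_ν are plain moments of ψ, while Gram matrices of
lifts are moments of h_ν. -/
lemma inner_div_weightedLift {ψ Φ : L2 (d + 2)}
    (hΦ : Φ =ᵐ[surf (d + 2)] fun m => ψ m / √(axialProfile d η ⟪b 0, (m : Euc d)⟫))
    (f : C(Sph (d + 2), ℝ)) :
    ⟪Φ, weightedLift b η f⟫ = ∫ m, f m * ψ m ∂(surf (d + 2)) := by
  rw [L2_inner_eq]
  refine integral_congr_ae ?_
  filter_upwards [coeFn_weightedLift b η f, hΦ] with m hf hm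
  have := (sqrt_pos.2 (axialProfile_pos d η ⟪b 0, (m : Euc d)⟫)).ne'
  rw [hf, hm]
  field_simp

lemma inner_axialSecondVariation {ν : Sph (d + 2)} (hb : b 0 = (ν : Euc d)) (ψ : V (d + 2))
    {Φ : L2 (d + 2)}
    (hΦ : Φ =ᵐ[surf (d + 2)] fun m => (ψ : L2 (d + 2)) m /
      √(axialProfile d η ⟪b 0, (m : Euc d)⟫)) :
    ⟪axialSecondVariation η ν ψ, ψ⟫ = ‖Φ‖ ^ 2 - sigma (d + 2) 1 η *
      ((∫ m : Sph (d + 2), ⟪b 0, (m : Euc d)⟫ ^ 2 * (ψ : L2 (d + 2)) m ∂(surf (d + 2))) ^ 2 +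
      2 * ∑ i : Fin (d + 1), (∫ m : Sph (d + 2), ⟪b 0, (m : Euc d)⟫ * ⟪b i.succ, (m : Euc d)⟫ *
        (ψ : L2 (d + 2)) m ∂(surf (d + 2))) ^ 2 +
      ∑ i : Fin (d + 1), ∑ j : Fin (d + 1), (∫ m : Sph (d + 2), ⟪b i.succ, (m : Euc d)⟫ *
        ⟪b j.succ, (m : Euc d)⟫ * (ψ : L2 (d + 2)) m ∂(surf (d + 2))) ^ 2) := by
  set α := sigma (d + 2) 1 η
  have hψ : Integrable (ψ : L2 (d + 2)) (surf (d + 2)) := (Lp.memLp _).integrable (by norm_num)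
  have hmean : ∫ m, (ψ : L2 (d + 2)) m ∂(surf (d + 2)) = 0 := ψ.2
  set X := ∫ m : Sph (d + 2), ⟪b 0, (m : Euc d)⟫ ^ 2 * (ψ : L2 (d + 2)) m ∂(surf (d + 2)) with hX
  set Q : Fin (d + 1) → ℝ := fun i => ∫ m : Sph (d + 2), ⟪b 0, (m : Euc d)⟫ *
    ⟪b i.succ, (m : Euc d)⟫ * (ψ : L2 (d + 2)) m ∂(surf (d + 2)) with hQ
  set R : Fin (d + 1) → Fin (d + 1) → ℝ := fun i j => ∫ m : Sph (d + 2), ⟪b i.succ, (m : Euc d)⟫ *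
    ⟪b j.succ, (m : Euc d)⟫ * (ψ : L2 (d + 2)) m ∂(surf (d + 2)) with hR
  set A := ⨍ m, preSecondVariation α (axial η ν) (ψ : L2 (d + 2)) m ∂(surf (d + 2)) with hA
  have i0 : Integrable (fun m : Sph (d + 2) => X * (⟪b 0, (m : Euc d)⟫ ^ 2 *
      (ψ : L2 (d + 2)) m)) (surf (d + 2)) :=
    (integrable_mul_continuous (by fun_prop) hψ).const_mul _
  have i1 : ∀ i : Fin (d + 1), Integrable (fun m : Sph (d + 2) => Q i * (⟪b 0, (m : Euc d)⟫ *
      ⟪b i.succ, (m : Euc d)⟫ * (ψ : L2 (d + 2)) m)) (surf (d + 2)) := fun i =>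
    (integrable_mul_continuous (by fun_prop) hψ).const_mul _
  have i2 : ∀ i j : Fin (d + 1), Integrable (fun m : Sph (d + 2) => R i j *
      (⟪b i.succ, (m : Euc d)⟫ * ⟪b j.succ, (m : Euc d)⟫ * (ψ : L2 (d + 2)) m))
      (surf (d + 2)) := fun i j =>
    (integrable_mul_continuous (by fun_prop) hψ).const_mul _
  have i3 : Integrable (fun m : Sph (d + 2) => X * (⟪b 0, (m : Euc d)⟫ ^ 2 *
      (ψ : L2 (d + 2)) m) + 2 * ∑ i : Fin (d + 1), Q i * (⟪b 0, (m : Euc d)⟫ *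
      ⟪b i.succ, (m : Euc d)⟫ * (ψ : L2 (d + 2)) m)) (surf (d + 2)) :=
    i0.add ((integrable_finsetSum _ fun i _ => i1 i).const_mul _)
  have i4 : Integrable (fun m : Sph (d + 2) => ∑ i : Fin (d + 1), ∑ j : Fin (d + 1), R i j *
      (⟪b i.succ, (m : Euc d)⟫ * ⟪b j.succ, (m : Euc d)⟫ * (ψ : L2 (d + 2)) m))
      (surf (d + 2)) :=
    integrable_finsetSum _ fun i _ => integrable_finsetSum _ fun j _ => i2 i j
  have i6 : Integrable (fun m : Sph (d + 2) => α * (X * (⟪b 0, (m : Euc d)⟫ ^ 2 *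
      (ψ : L2 (d + 2)) m) + 2 * ∑ i : Fin (d + 1), Q i * (⟪b 0, (m : Euc d)⟫ *
      ⟪b i.succ, (m : Euc d)⟫ * (ψ : L2 (d + 2)) m) +
      ∑ i : Fin (d + 1), ∑ j : Fin (d + 1), R i j * (⟪b i.succ, (m : Euc d)⟫ *
      ⟪b j.succ, (m : Euc d)⟫ * (ψ : L2 (d + 2)) m))) (surf (d + 2)) := (i3.add i4).const_mul α
  have i5 : Integrable (fun m : Sph (d + 2) => α * (X * (⟪b 0, (m : Euc d)⟫ ^ 2 *
      (ψ : L2 (d + 2)) m) + 2 * ∑ i : Fin (d + 1), Q i * (⟪b 0, (m : Euc d)⟫ *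
      ⟪b i.succ, (m : Euc d)⟫ * (ψ : L2 (d + 2)) m) +
      ∑ i : Fin (d + 1), ∑ j : Fin (d + 1), R i j *
      (⟪b i.succ, (m : Euc d)⟫ * ⟪b j.succ, (m : Euc d)⟫ * (ψ : L2 (d + 2)) m)) +
      A * (ψ : L2 (d + 2)) m) (surf (d + 2)) :=
    i6.add (hψ.const_mul A)
  have e0 : ∀ i : Fin (d + 1), ∫ m : Sph (d + 2), ∑ j : Fin (d + 1), R i j *
      (⟪b i.succ, (m : Euc d)⟫ * ⟪b j.succ, (m : Euc d)⟫ * (ψ : L2 (d + 2)) m) ∂(surf (d + 2)) =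
      _ := fun i => integral_finsetSum _ fun j _ => i2 i j
  -- The term Aψ integrates to zero because ψ has mean zero; including it accounts for the
  -- subtracted average.
  have hK : α * (X ^ 2 + 2 * ∑ i, Q i ^ 2 + ∑ i, ∑ j, R i j ^ 2) =
      ∫ m : Sph (d + 2), (α * (X * (⟪b 0, (m : Euc d)⟫ ^ 2 *
      (ψ : L2 (d + 2)) m) + 2 * ∑ i : Fin (d + 1), Q i * (⟪b 0, (m : Euc d)⟫ *
      ⟪b i.succ, (m : Euc d)⟫ * (ψ : L2 (d + 2)) m) +
      ∑ i : Fin (d + 1), ∑ j : Fin (d + 1), R i j *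
      (⟪b i.succ, (m : Euc d)⟫ * ⟪b j.succ, (m : Euc d)⟫ * (ψ : L2 (d + 2)) m)) +
      A * (ψ : L2 (d + 2)) m) ∂(surf (d + 2)) := by
    rw [integral_add i6 (hψ.const_mul A), integral_const_mul,
      integral_const_mul, hmean, mul_zero, add_zero, integral_add i3 i4, integral_add i0
      ((integrable_finsetSum _ fun i _ => i1 i).const_mul _), integral_const_mul,
      integral_const_mul, integral_finsetSum _ fun i _ => i1 i, integral_finsetSum _ fun i _ =>
      integrable_finsetSum _ fun j _ => i2 i j]
    simp only [e0, integral_const_mul, ← hX]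
    simp only [hQ, hR, sq]
  rw [hK, ← real_inner_self_eq_norm_sq, L2_inner_eq, ← integral_sub (integrable_L2_mul Φ Φ) i5,
    Submodule.coe_inner, L2_inner_eq]
  refine integral_congr_ae ?_
  filter_upwards [coeFn_secondVariation α _ (axial_continuous η ν) (axial_pos η ν) ψ, hΦ]
    with m hm hm'
  have hpos := axialProfile_pos d η ⟪b 0, (m : Euc d)⟫
  have hs := mul_self_sqrt hpos.le
  have hne := (sqrt_pos.2 hpos).ne'
  rw [axialSecondVariation, hm, hm', secondVariationFun, ← hA, preSecondVariation,
    integral_kernel_mul b hψ, axial_eq_axialProfile b η hb]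
  have hdiv : (ψ : L2 (d + 2)) m / √(axialProfile d η ⟪b 0, (m : Euc d)⟫) *
      ((ψ : L2 (d + 2)) m / √(axialProfile d η ⟪b 0, (m : Euc d)⟫)) =
      (ψ : L2 (d + 2)) m / axialProfile d η ⟪b 0, (m : Euc d)⟫ * (ψ : L2 (d + 2)) m := by
    rw [div_mul_div_comm, hs]
    ring
  rw [hdiv]
  have e1 : ∀ i, Q i * (⟪b 0, (m : Euc d)⟫ * ⟪b i.succ, (m : Euc d)⟫ * (ψ : L2 (d + 2)) m) =
    ⟪b 0, (m : Euc d)⟫ * ⟪b i.succ, (m : Euc d)⟫ * Q i * (ψ : L2 (d + 2)) m := fun i => by ring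
  have e2 : ∀ i j, R i j * (⟪b i.succ, (m : Euc d)⟫ * ⟪b j.succ, (m : Euc d)⟫ *
    (ψ : L2 (d + 2)) m) = ⟪b i.succ, (m : Euc d)⟫ * ⟪b j.succ, (m : Euc d)⟫ * R i j *
    (ψ : L2 (d + 2)) m := fun i j => by ring
  simp only [e1, e2, ← Finset.sum_mul]
  simp only [hX, hQ, hR]
  ring

/-- The spectral gap constant. -/
def gap (d : ℕ) (η : ℝ) : ℝ :=
  min (1 - (d + 2) * (sinMean d η - sinMean d η ^ 2 - sinCosMean d η) / (2 * sinCosMean d η))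
    (1 - (1 - sinMean d η - sinCosMean d η) / ((d + 3) * sinCosMean d η))

/-- Positivity of the first entry of the minimum is S < 0 rewritten; that of the second is
`perp_fourth_lt`. -/
lemma gap_pos (d : ℕ) {η : ℝ} (hη : 0 < η) (h : sinSlope d η < 0) : 0 < gap d η := by
  have hw := sinCosMean_pos d η
  refine lt_min (sub_pos.2 ((div_lt_one (by positivity)).2 ?_))
    (sub_pos.2 ((div_lt_one (by positivity)).2 (perp_fourth_lt d hη)))
  unfold sinSlope at h
  linarith

lemma inner_weightedLift_radial :
    ⟪weightedLift b η (coord b 0 * coord b 0 - ContinuousMap.const _ (sinMean d η)),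
      weightedLift b η (coord b 0 * coord b 0 - ContinuousMap.const _ (sinMean d η))⟫ =
      sinMean d η - sinMean d η ^ 2 - sinCosMean d η := by
  rw [inner_weightedLift, integral_axialProfile_quadratic b η (sinMean d η ^ 2)
    (-(2 * sinMean d η)) 1 fun m => by
      simp only [coord, ContinuousMap.mul_apply, ContinuousMap.coe_mk, ContinuousMap.sub_apply,
        ContinuousMap.const_apply]
      ring]
  ring

lemma inner_weightedLift_radial_tangent (i : Fin (d + 1)) (a : ℝ) :
    ⟪weightedLift b η (coord b 0 * coord b 0 - ContinuousMap.const _ a),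
      weightedLift b η (coord b 0 * coord b i.succ)⟫ = 0 := by
  rw [inner_weightedLift]
  exact integral_axialProfile_odd b η (f := fun x y => (x * x - a) * (x * y i)) (by fun_prop)
    fun x y => by ring

lemma inner_weightedLift_tangent (i j : Fin (d + 1)) :
    ⟪weightedLift b η (coord b 0 * coord b i.succ),
      weightedLift b η (coord b 0 * coord b j.succ)⟫ =
      if i = j then sinCosMean d η / (d + 1) else 0 := by
  rw [inner_weightedLift, ← integral_axialProfile_sq_perp b]
  refine integral_congr_ae (Filter.Eventually.of_forall fun m => ?_)
  simp only [coord, ContinuousMap.mul_apply, ContinuousMap.coe_mk]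
  ring

lemma inner_weightedLift_tangent_perp (i j k : Fin (d + 1)) :
    ⟪weightedLift b η (coord b 0 * coord b i.succ),
      weightedLift b η (coord b j.succ * coord b k.succ)⟫ = 0 := by
  rw [inner_weightedLift]
  exact integral_axialProfile_odd b η (f := fun x y => (x * y i) * (y j * y k)) (by fun_prop)
    fun x y => by ring

lemma inner_weightedLift_radial_perp (i j : Fin (d + 1)) (a : ℝ) :
    ⟪weightedLift b η (coord b 0 * coord b 0 - ContinuousMap.const _ a),
      weightedLift b η (coord b i.succ * coord b j.succ)⟫ =
      if i = j then sinCosMean d η / (d + 1) - a * ((1 - sinMean d η) / (d + 1)) else 0 := by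
  have hcont := (contDiff_axialProfile d η).continuous
  rw [inner_weightedLift]
  have h1 := integral_axialProfile_sq_perp b η i j
  have h2 := integral_axialProfile_perp b η i j
  have h3 : (if i = j then sinCosMean d η / (d + 1) - a * ((1 - sinMean d η) / (d + 1)) else 0) =
      (if i = j then sinCosMean d η / (d + 1) else 0) -
        a * (if i = j then (1 - sinMean d η) / (d + 1) else 0) := by split_ifs <;> ring
  rw [h3, ← h1, ← h2, ← integral_const_mul, ← integral_sub
    (integrable_of_continuous (by fun_prop)) (integrable_of_continuous (by fun_prop))]
  refine integral_congr_ae (Filter.Eventually.of_forall fun m => ?_)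
  simp only [coord, ContinuousMap.mul_apply, ContinuousMap.coe_mk, ContinuousMap.sub_apply,
    ContinuousMap.const_apply]
  ring

lemma inner_weightedLift_perp (i j k l : Fin (d + 1)) :
    ⟪weightedLift b η (coord b i.succ * coord b j.succ),
      weightedLift b η (coord b k.succ * coord b l.succ)⟫ =
      (if i = k then if j = l then
        (1 - sinMean d η - sinCosMean d η) / ((d + 1) * (d + 3)) else 0 else 0) +
      (if i = l then if j = k then
        (1 - sinMean d η - sinCosMean d η) / ((d + 1) * (d + 3)) else 0 else 0) +
      if i = j then if k = l then
        (1 - sinMean d η - sinCosMean d η) / ((d + 1) * (d + 3)) else 0 else 0 := by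
  rw [inner_weightedLift]
  have h := integral_axialProfile_perp_fourth b η i j k l
  generalize (1 - sinMean d η - sinCosMean d η) / (((d : ℝ) + 1) * (d + 3)) = W at h ⊢
  have h3 : (((if i = k then if j = l then W else 0 else 0) +
      (if i = l then if j = k then W else 0 else 0) +
      if i = j then if k = l then W else 0 else 0) : ℝ) =
      ((if i = j then 1 else 0) * (if k = l then 1 else 0) +
      (if i = k then 1 else 0) * (if j = l then 1 else 0) +
      (if i = l then 1 else 0) * (if j = k then 1 else 0)) * W := by
    simp only [ite_mul, one_mul, zero_mul, add_mul]
    ring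
  rw [h3, ← h]
  refine integral_congr_ae (Filter.Eventually.of_forall fun m => ?_)
  simp only [coord, ContinuousMap.mul_apply, ContinuousMap.coe_mk]
  ring

section Pairing

variable {ψ Φ : L2 (d + 2)}

/-- As ψ has mean zero, the constant a is free. Taking it to be the mean of x² makes ‖p‖² the
variance, the smallest possible value. -/
lemma inner_div_weightedLift_radial (hmean : ∫ m, ψ m ∂(surf (d + 2)) = 0)
    (hΦ : Φ =ᵐ[surf (d + 2)] fun m => ψ m / √(axialProfile d η ⟪b 0, (m : Euc d)⟫)) (a : ℝ) :
    ⟪Φ, weightedLift b η (coord b 0 * coord b 0 - ContinuousMap.const _ a)⟫ =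
      ∫ m : Sph (d + 2), ⟪b 0, (m : Euc d)⟫ ^ 2 * ψ m ∂(surf (d + 2)) := by
  have hψ : Integrable ψ (surf (d + 2)) := (Lp.memLp _).integrable (by norm_num)
  rw [inner_div_weightedLift b η hΦ]
  have i1 : Integrable (fun m : Sph (d + 2) => ⟪b 0, (m : Euc d)⟫ ^ 2 * ψ m) (surf (d + 2)) :=
    integrable_mul_continuous (by fun_prop) hψ
  have : ∫ m : Sph (d + 2), (⟪b 0, (m : Euc d)⟫ ^ 2 * ψ m - a * ψ m) ∂(surf (d + 2)) =
      ∫ m : Sph (d + 2), ⟪b 0, (m : Euc d)⟫ ^ 2 * ψ m ∂(surf (d + 2)) := by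
    rw [integral_sub i1 (hψ.const_mul a), integral_const_mul, hmean, mul_zero, sub_zero]
  rw [← this]
  refine integral_congr_ae (Filter.Eventually.of_forall fun m => ?_)
  simp only [coord, ContinuousMap.mul_apply, ContinuousMap.coe_mk, ContinuousMap.sub_apply,
    ContinuousMap.const_apply]
  ring

/-- The trace condition of `gram_coercive`: Σ yᵢ² = 1 - x², and ψ has mean zero. -/
lemma sum_inner_div_weightedLift_perp (hmean : ∫ m, ψ m ∂(surf (d + 2)) = 0)
    (hΦ : Φ =ᵐ[surf (d + 2)] fun m => ψ m / √(axialProfile d η ⟪b 0, (m : Euc d)⟫)) (a : ℝ) :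
    ∑ i : Fin (d + 1), ⟪Φ, weightedLift b η (coord b i.succ * coord b i.succ)⟫ =
      -⟪Φ, weightedLift b η (coord b 0 * coord b 0 - ContinuousMap.const _ a)⟫ := by
  have hψ : Integrable ψ (surf (d + 2)) := (Lp.memLp _).integrable (by norm_num)
  rw [inner_div_weightedLift_radial b η hmean hΦ]
  simp only [inner_div_weightedLift b η hΦ]
  rw [← integral_finsetSum _ fun i _ =>
    integrable_mul_continuous (coord b i.succ * coord b i.succ).continuous hψ]
  have i1 : Integrable (fun m : Sph (d + 2) => ⟪b 0, (m : Euc d)⟫ ^ 2 * ψ m) (surf (d + 2)) :=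
    integrable_mul_continuous (by fun_prop) hψ
  have h2 := integral_sub hψ i1
  rw [hmean, zero_sub] at h2
  rw [← h2]
  refine integral_congr_ae (Filter.Eventually.of_forall fun m => ?_)
  simp only [coord, ContinuousMap.mul_apply, ContinuousMap.coe_mk]
  rw [← Finset.sum_mul]
  simp only [← sq, sum_inner_succ_sq]
  ring

end Pairing

lemma gap_mul_norm_sq_le {ν : Sph (d + 2)} (hb : b 0 = (ν : Euc d)) (ψ : V (d + 2))
    {Φ : L2 (d + 2)}
    (hΦ : Φ =ᵐ[surf (d + 2)] fun m => (ψ : L2 (d + 2)) m /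
      √(axialProfile d η ⟪b 0, (m : Euc d)⟫)) :
    gap d η * ‖Φ - (2 * sigma (d + 2) 1 η) • ∑ i : Fin (d + 1),
      ⟪Φ, weightedLift b η (coord b 0 * coord b i.succ)⟫ •
        weightedLift b η (coord b 0 * coord b i.succ)‖ ^ 2 ≤
      ⟪axialSecondVariation η ν ψ, ψ⟫ := by
  have hw := sinCosMean_pos d η
  have hd : (0 : ℝ) < d + 1 := by positivity
  have hmean : ∫ m, (ψ : L2 (d + 2)) m ∂(surf (d + 2)) = 0 := ψ.2
  have hα : sigma (d + 2) 1 η = (d + 1) / (2 * sinCosMean d η) := sigma_one_eq d η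
  have h1 : sigma (d + 2) 1 η * (((Fintype.card (Fin (d + 1)) : ℝ) + 1) /
      Fintype.card (Fin (d + 1)) * (sinMean d η - sinMean d η ^ 2 - sinCosMean d η)) ≤
      1 - gap d η := by
    refine le_trans (le_of_eq ?_) (le_sub_comm.1 (min_le_left _ _))
    rw [hα, Fintype.card_fin]
    push_cast
    field_simp
    ring
  have h2 : sigma (d + 2) 1 η * (2 * ((1 - sinMean d η - sinCosMean d η) /
      ((d + 1) * (d + 3)))) ≤ 1 - gap d η := by
    refine le_trans (le_of_eq ?_) (le_sub_comm.1 (min_le_right _ _))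
    rw [hα]
    field_simp
  have h3 : 0 < sigma (d + 2) 1 η := by rw [hα]; positivity
  have h4 : 2 * sigma (d + 2) 1 η * (sinCosMean d η / (d + 1)) = 1 := by rw [hα]; field_simp
  have key := gram_coercive (F := Φ)
    (p := weightedLift b η (coord b 0 * coord b 0 - ContinuousMap.const _ (sinMean d η)))
    (q := fun i : Fin (d + 1) => weightedLift b η (coord b 0 * coord b i.succ))
    (r := fun i j => weightedLift b η (coord b i.succ * coord b j.succ))
    (inner_weightedLift_radial b η) (fun i => inner_weightedLift_radial_tangent b η i _)
    (inner_weightedLift_tangent b η) (inner_weightedLift_tangent_perp b η)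
    (fun i j => inner_weightedLift_radial_perp b η i j _) (inner_weightedLift_perp b η)
    (sum_inner_div_weightedLift_perp b η hmean hΦ _)
    (fun i j => by rw [mul_comm (coord b i.succ)]) h3 h4 h1 h2
  refine key.trans_eq ?_
  rw [inner_axialSecondVariation b η hb ψ hΦ, inner_div_weightedLift_radial b η hmean hΦ]
  simp only [inner_div_weightedLift b η hΦ]
  rfl

/-- Coercivity of the second variation, up to an element of `Vtop`. -/
lemma exists_mem_Vtop_coercive (hη : 0 ≤ η) (hg : 0 < gap d η) {ν : Sph (d + 2)}
    (ψ : V (d + 2)) :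
    ∃ φ ∈ Vtop η ν, gap d η / axialProfile d η 1 * ‖(ψ : L2 (d + 2)) - φ‖ ^ 2 ≤
      ⟪axialSecondVariation η ν ψ, ψ⟫ := by
  obtain ⟨b, hb⟩ := exists_basis_first ν
  obtain ⟨Φ, hΦ⟩ := exists_div_sqrtProfile b η (ψ : L2 (d + 2))
  have hcont := (contDiff_axialProfile d η).continuous
  have hge := gap_mul_norm_sq_le b η hb ψ hΦ
  set c : Fin (d + 1) → ℝ := fun i => 2 * sigma (d + 2) 1 η *
    ⟪Φ, weightedLift b η (coord b 0 * coord b i.succ)⟫ with hc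
  set g : C(Sph (d + 2), ℝ) := ∑ i, c i • (coord b 0 * coord b i.succ) with hgdef
  have hlift : (2 * sigma (d + 2) 1 η) • ∑ i : Fin (d + 1),
      ⟪Φ, weightedLift b η (coord b 0 * coord b i.succ)⟫ •
        weightedLift b η (coord b 0 * coord b i.succ) = weightedLift b η g := by
    simp only [weightedLift, hgdef, Finset.smul_sum, smul_smul, Finset.sum_mul, map_sum,
      smul_mul_assoc, map_smul, hc]
  rw [hlift] at hge
  have hgm : ∀ m : Sph (d + 2), g m =
      ∑ i, c i * (⟪b 0, (m : Euc d)⟫ * ⟪b i.succ, (m : Euc d)⟫) := fun m => by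
    simp [hgdef, coord]
  -- A second factor √h_ν carries the projection of Φ back to the scale of ψ, where it lies in
  -- `Vtop`.
  set φ : L2 (d + 2) := weightedLift b η (g * sqrtProfile b η) with hφ
  have hφm : φ =ᵐ[surf (d + 2)] fun m => g m * axialProfile d η ⟪b 0, (m : Euc d)⟫ := by
    filter_upwards [coeFn_weightedLift b η (g * sqrtProfile b η)] with m hm
    rw [hφ, hm]
    have hs := mul_self_sqrt (axialProfile_pos d η ⟪b 0, (m : Euc d)⟫).le
    simp only [ContinuousMap.mul_apply, sqrtProfile, ContinuousMap.coe_mk]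
    rw [mul_assoc, hs]
  refine ⟨φ, (mem_Vtop_iff hb η φ).2 ⟨c, ?_⟩, ?_⟩
  · filter_upwards [hφm] with m hm
    rw [hm, hgm]
  have hP := axialProfile_pos d η 1
  -- ψ - φ is √h_ν times the remainder of Φ, and for η ≥ 0 the density is largest at the pole x = 1.
  -- The bound does not involve ν.
  have hle : ‖(ψ : L2 (d + 2)) - φ‖ ≤ √(axialProfile d η 1) * ‖Φ - weightedLift b η g‖ := by
    refine Lp.norm_le_mul_norm_of_ae_le_mul ?_
    filter_upwards [hφm, hΦ, coeFn_weightedLift b η g, Lp.coeFn_sub (ψ : L2 (d + 2)) φ,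
      Lp.coeFn_sub Φ (weightedLift b η g)] with m h1 h2 h3 h4 h5
    have hpos := axialProfile_pos d η ⟪b 0, (m : Euc d)⟫
    have hs := mul_self_sqrt hpos.le
    have hne := (sqrt_pos.2 hpos).ne'
    rw [h4, h5, Pi.sub_apply, Pi.sub_apply, h1, h2, h3]
    have e : (ψ : L2 (d + 2)) m - g m * axialProfile d η ⟪b 0, (m : Euc d)⟫ =
        √(axialProfile d η ⟪b 0, (m : Euc d)⟫) * ((ψ : L2 (d + 2)) m /
          √(axialProfile d η ⟪b 0, (m : Euc d)⟫) -
          g m * √(axialProfile d η ⟪b 0, (m : Euc d)⟫)) := by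
      rw [mul_sub, mul_div_cancel₀ _ hne]
      linear_combination g m * hs
    rw [e, norm_mul, norm_of_nonneg (sqrt_nonneg _)]
    refine mul_le_mul_of_nonneg_right (sqrt_le_sqrt (axialProfile_le d hη ?_)) (norm_nonneg _)
    have := abs_real_inner_le_norm (b 0) (m : Euc d)
    rwa [b.norm_eq_one, norm_eq_of_mem_sphere, mul_one] at this
  refine le_trans ?_ hge
  rw [div_mul_eq_mul_div, div_le_iff₀ hP, mul_assoc]
  refine mul_le_mul_of_nonneg_left ?_ hg.le
  calc ‖(ψ : L2 (d + 2)) - φ‖ ^ 2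
      ≤ (√(axialProfile d η 1) * ‖Φ - weightedLift b η g‖) ^ 2 := by gcongr
    _ = ‖Φ - weightedLift b η g‖ ^ 2 * axialProfile d η 1 := by
      rw [mul_pow, sq_sqrt hP.le, mul_comm]

end Coercive

end Onsager

end

/-! ### The theorem. -/

/-- The number `ηs` is the argmin of `σ_1` (its unique global minimum point); the constant `c₀`
depends on `η` and `n` only. -/
theorem theorem1p2 (n : ℕ) (hn : 2 ≤ n) :
    ∃ ηs : ℝ, (∀ x : ℝ, x ≠ ηs → Onsager.sigma n 1 ηs < Onsager.sigma n 1 x) ∧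
      ∀ η : ℝ, ηs < η → ∃ c₀ : ℝ, 0 < c₀ ∧ ∀ ν : Onsager.Sph n,
        Onsager.IsCriticalPoint (Onsager.sigma n 1 η) (Onsager.axial η ν) ∧
          (LinearMap.ker (Onsager.axialSecondVariation η ν)).map (Onsager.V n).subtype =
            Onsager.Vtop η ν ∧
          ∀ ψ : Onsager.V n,
            (∀ φ ∈ Onsager.Vtop η ν, inner ℝ (ψ : Onsager.L2 n) φ = 0) →
              c₀ * ‖ψ‖ ^ 2 ≤ inner ℝ (Onsager.axialSecondVariation η ν ψ) ψ := by
  obtain ⟨d, rfl⟩ := Nat.exists_eq_add_of_le' hn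
  obtain ⟨ηs, h0, hmax, hslope⟩ := Onsager.exists_sinCosMean_strict_max d
  refine ⟨ηs, fun x hx => ?_, fun η hη => ?_⟩
  · have h1 := Onsager.sinCosMean_pos d x
    rw [Onsager.sigma_one_eq, Onsager.sigma_one_eq]
    exact div_lt_div_of_pos_left (by positivity) (by positivity) (by linarith [hmax x hx])
  have hη0 : 0 < η := h0.trans_lt hη
  have hg := Onsager.gap_pos d hη0 (hslope η hη)
  have hc := div_pos hg (Onsager.axialProfile_pos d η 1)
  refine ⟨_, hc, fun ν => ⟨Onsager.axial_isCriticalPoint d η ν, ?_, fun ψ hψ => ?_⟩⟩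
  · refine le_antisymm ?_ (Onsager.Vtop_le_ker d η ν)
    rintro _ ⟨ψ, hψ, rfl⟩
    obtain ⟨φ, hφ, hle⟩ := Onsager.exists_mem_Vtop_coercive η hη0.le hg (ν := ν) ψ
    rw [LinearMap.mem_ker.1 hψ, inner_zero_left] at hle
    -- On the kernel the form vanishes, so ψ coincides with its approximation φ in `Vtop`.
    have h1 : ‖(ψ : Onsager.L2 (d + 2)) - φ‖ ^ 2 ≤ 0 := nonpos_of_mul_nonpos_right hle hc
    have h2 : (ψ : Onsager.L2 (d + 2)) - φ = 0 :=
      norm_eq_zero.1 (pow_eq_zero_iff two_ne_zero |>.1 (le_antisymm h1 (sq_nonneg _)))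
    rw [Submodule.subtype_apply, sub_eq_zero.1 h2]
    exact hφ
  · obtain ⟨φ, hφ, hle⟩ := Onsager.exists_mem_Vtop_coercive η hη0.le hg (ν := ν) ψ
    refine le_trans (mul_le_mul_of_nonneg_left ?_ hc.le) hle
    -- By orthogonality ‖ψ - φ‖² = ‖ψ‖² + ‖φ‖² ≥ ‖ψ‖².
    rw [norm_sub_sq_real, hψ φ hφ, Submodule.coe_norm]
    linarith [sq_nonneg ‖φ‖]
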